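/- **Setting.** Let $\mathcal X$ be a measurable space, $A=\mathcal Y=\{0,1\}$, and let $\mathcal H$ be a class of measurable classifiers $h:\mathcal X\to\{0,1\}$ with finite VC dimension $d$. Let $\mathbb P$ be a probability distribution of $(X,A,Y)$ on $\mathcal X\times A\times\mathcal Y$, and let $P_{1a}=\mathbb P(Y=1,A=a)$, where $0<P_{10}\le P_{11}$. We make the usual measurability assumption on $\mathcal H$: for all $m$ and $b\in\{0,1\}^m$, the set of those $(x_1,\dots,x_m)\in\mathcal X^m$ for which some $h\in\mathcal H$ has $h(x_i)=b_i$ for all $i$ is measurable with respect to the completion of the $m$-fold product of the law of $X$ (this holds, for instance, if $\mathcal H$ is countable). For $\lambda\ge 0$ put $$L_\lambda(h)=\mathbb P(h(X)\ne Y)+\lambda\,\bigl|\mathbb P(h(X)=1\mid A=0,Y=1)-\mathbb P(h(X)=1\mid A=1,Y=1)\bigr| .$$ For a dataset $S=((x_i,a_i,y_i))_{i=1}^n$ put $$\widehat L_\lambda(h,S)=\frac1n\sum_{i=1}^n \mathbf 1\{h(x_i)\neq y_i\}+\lambda\,\bigl|\widehat\gamma_{0}-\widehat\gamma_{1}\bigr|,\qquad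 \widehat\gamma_a=\frac{\sum_i\mathbf 1\{h(x_i)=1,a_i=a,y_i=1\}}{\sum_i\mathbf 1\{a_i=a,y_i=1\}},$$ with the convention $0/0=0$. Let $\mathcal L$ be any learner that maps every nonempty finite dataset $S$ to a minimizer of $\widehat L_\lambda(\cdot,S)$ over $\mathcal H$. A malicious adversary of power $\alpha\in[0,1/2)$ acts as follows: a clean i.i.d. sample $S^c$ of size $n$ is drawn from $\mathbb P$; each index is marked independently (and independently of $S^c$) with probability $\alpha$; knowing everything, the adversary replaces the marked points arbitrarily, possibly at random, and leaves the unmarked ones unchanged. The result is the corrupted dataset $S^p$, and $\mathbb P^{\mathcal A}$ denotes probability over the clean data, the marks and the randomness of the adversary. **Theorem.** There is an absolute constant $C>0$ such that, for all $\mathcal X,\mathcal H,d,\lambda,\mathcal L,\mathbb P$ as above, every $\alpha\in[0,1/2)$, every $\delta\in(0,1)$, every $$n\ \ge\ \max\Bigl\{\frac{8\log(16/\delta)}{(1-\alpha)P_{10}},\ \frac{12\log(12/\delta)}{\alpha},\ \frac d2\Bigr\}$$ (the second term being omitted if $\alpha=0$), and every malicious adversary $\mathcal A$ of power $\alpha$,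 $$\mathbb P^{\mathcal A}\Bigl(L_\lambda(\mathcal L(S^p))\ \le\ \inf_{h\in\mathcal H}L_\lambda(h)+\Delta_\lambda\Bigr)>1-\delta ,$$ where $$\Delta_\lambda=3\alpha+2\lambda\,\frac{2\alpha}{P_{10}/3+\alpha}+C\left(\sqrt{\frac{d\log(2en/d)+\log(1/\delta)}{n}}+\lambda\sqrt{\frac{d\log(2en/d)+\log(1/\delta)}{P_{10}\,n}}\right),$$ and $d\log(2en/d)$ is read as $0$ for $d=0$. That is, $\Delta_\lambda=3\alpha+2\lambda\frac{2\alpha}{P_{10}/3+\alpha}+\widetilde{\mathcal O}\bigl(\sqrt{d/n}+\lambda\sqrt{d/(P_{10}n)}\bigr)$. (If the event is not measurable, the claim is that its complement has outer probability less than $\delta$.) -/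

import Mathlib

open MeasureTheory

universe u v

namespace FairLearning

/-- A labelled example `(x, a, y)`: input, protected attribute, label. The binary attribute and
the binary label take values in `Bool`, with `false` for `0` and `true` for `1`. -/
abbrev Example (X : Type u) : Type u := X × Bool × Bool

/-- A dataset of size `n`. -/
abbrev Dataset (X : Type u) (n : ℕ) : Type u := Fin n → Example X

/-- A classifier `X → {0, 1}`. -/
abbrev Classifier (X : Type u) : Type u := X → Bool

/-- `H` shatters the finite set `s`: every labelling of `s` is realized by a member of `H`. -/
def Shatters {X : Type u} (H : Set (Classifier X)) (s : Finset X) : Prop :=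
  ∀ t ⊆ s, ∃ h ∈ H, ∀ x ∈ s, h x = true ↔ x ∈ t

/-- The Vapnik-Chervonenkis dimension: supremum of the sizes of the shattered finite sets. -/
noncomputable def vcDim {X : Type u} (H : Set (Classifier X)) : ℕ∞ :=
  ⨆ (s : Finset X) (_ : Shatters H s), (s.card : ℕ∞)

/-- Measurability convention for a hypothesis class: every classifier is measurable, and, for each
labelling pattern `b` of `m` points, the set of the `m`-tuples of inputs on which some `h ∈ H`
realizes `b` is measurable for the completion of the `m`-fold product of the input marginal.
(Equivalently, suprema over `H` of functions of finitely many values of `h` are measurable.)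
It holds for countable classes of measurable classifiers, and for all the pointwise separable
ones. -/
def MeasurableClass {X : Type u} [MeasurableSpace X] (P : Measure (Example X))
    (H : Set (Classifier X)) : Prop :=
  (∀ h ∈ H, Measurable h) ∧
  ∀ (m : ℕ) (b : Fin m → Bool),
    NullMeasurableSet {x : Fin m → X | ∃ h ∈ H, ∀ i, h (x i) = b i}
      (Measure.pi fun _ : Fin m => P.map Prod.fst)

/-- The event `{A = a, Y = 1}`. -/
def posGroup (X : Type u) (a : Bool) : Set (Example X) := {z | z.2.1 = a ∧ z.2.2 = true}

/-- `P_{1a} = ℙ(Y = 1, A = a)`. -/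
noncomputable def posRate {X : Type u} [MeasurableSpace X] (P : Measure (Example X)) (a : Bool) :
    ℝ :=
  P.real (posGroup X a)

/-- The risk `ℙ(h(X) ≠ Y)`. -/
noncomputable def risk {X : Type u} [MeasurableSpace X] (P : Measure (Example X))
    (h : Classifier X) : ℝ :=
  P.real {z | h z.1 ≠ z.2.2}

/-- The true positive rate in group `a`: `ℙ(h(X) = 1 | A = a, Y = 1)`. -/
noncomputable def truePosRate {X : Type u} [MeasurableSpace X] (P : Measure (Example X))
    (h : Classifier X) (a : Bool) : ℝ :=
  (ProbabilityTheory.cond P (posGroup X a)).real {z | h z.1 = true}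

/-- The equal opportunity deviation measure of `h`. -/
noncomputable def oppDeviation {X : Type u} [MeasurableSpace X] (P : Measure (Example X))
    (h : Classifier X) : ℝ :=
  |truePosRate P h false - truePosRate P h true|

/-- The weighted objective `risk + lam * deviation`. -/
noncomputable def oppObjective {X : Type u} [MeasurableSpace X] (P : Measure (Example X))
    (lam : ℝ) (h : Classifier X) : ℝ :=
  risk P h + lam * oppDeviation P h

/-- The empirical risk of `h` on the dataset `S`. -/
noncomputable def empRisk {X : Type u} {n : ℕ} (S : Dataset X n) (h : Classifier X) : ℝ :=
  ((Finset.univ.filter fun i => h (S i).1 ≠ (S i).2.2).card : ℝ) / n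

/-- The empirical true positive rate of `h` in group `a`, with the convention `0 / 0 = 0`. -/
noncomputable def empTruePosRate {X : Type u} {n : ℕ} (S : Dataset X n) (h : Classifier X)
    (a : Bool) : ℝ :=
  ((Finset.univ.filter fun i =>
      h (S i).1 = true ∧ (S i).2.1 = a ∧ (S i).2.2 = true).card : ℝ) /
    ((Finset.univ.filter fun i => (S i).2.1 = a ∧ (S i).2.2 = true).card : ℝ)

/-- The empirical estimate of the equal opportunity deviation. -/
noncomputable def empOppDeviation {X : Type u} {n : ℕ} (S : Dataset X n) (h : Classifier X) : ℝ :=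
  |empTruePosRate S h false - empTruePosRate S h true|

/-- The empirical weighted objective. -/
noncomputable def empOppObjective {X : Type u} {n : ℕ} (lam : ℝ) (S : Dataset X n)
    (h : Classifier X) : ℝ :=
  empRisk S h + lam * empOppDeviation S h

/-- A learner maps datasets of any size to classifiers. -/
abbrev Learner (X : Type u) : Type u := (n : ℕ) → Dataset X n → Classifier X

/-- The learner always returns a minimizer over `H` of the empirical weighted objective. -/
def IsOppMinimizer {X : Type u} (H : Set (Classifier X)) (lam : ℝ) (L : Learner X) : Prop :=
  ∀ n : ℕ, 1 ≤ n → ∀ S : Dataset X n,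
    L n S ∈ H ∧ ∀ h ∈ H, empOppObjective lam S (L n S) ≤ empOppObjective lam S h

/-- A malicious adversary acting on datasets of size `n`: a randomized function (with a random
seed) of the clean dataset and of the marks (`true` = marked), which may replace the marked points
arbitrarily and leaves the other points unchanged. Since the function is arbitrary, it may depend
on every parameter of the learning problem; it is not even required to be measurable. -/
structure MaliciousAdversary (X : Type u) (n : ℕ) where
  /-- The space of the random seeds. -/
  Seed : Type v
  /-- The σ-algebra on the seeds. -/
  seedSpace : MeasurableSpace Seed
  /-- The law of the seed. -/
  seedLaw : Measure Seed
  /-- The law of the seed is a probability measure. -/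
  seedProb : IsProbabilityMeasure seedLaw
  /-- The corrupted dataset. -/
  corrupt : Dataset X n → (Fin n → Bool) → Seed → Dataset X n
  /-- Unmarked points are left unchanged. -/
  corrupt_unmarked : ∀ S marks r i, marks i = false → corrupt S marks r i = S i

attribute [instance] MaliciousAdversary.seedSpace MaliciousAdversary.seedProb

/-- The law of a single mark: `true` with probability `α`, `false` with probability `1 - α`. -/
noncomputable def markLaw (α : ℝ) : Measure Bool :=
  ENNReal.ofReal α • Measure.dirac true + ENNReal.ofReal (1 - α) • Measure.dirac false

/-- The joint law of all the randomness in the generation of the corrupted data, for an adversary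
of power `α`: the i.i.d. clean data, the independent marks, and the seed of the adversary. -/
noncomputable def processLaw {X : Type u} [MeasurableSpace X] {n : ℕ} (P : Measure (Example X))
    (α : ℝ) (𝒜 : MaliciousAdversary.{u, v} X n) :
    Measure (Dataset X n × (Fin n → Bool) × 𝒜.Seed) :=
  (Measure.pi fun _ => P).prod ((Measure.pi fun _ => markLaw α).prod 𝒜.seedLaw)

/-- The corrupted dataset as a function of the outcome of the generation process. -/
def corrupted {X : Type u} {n : ℕ} (𝒜 : MaliciousAdversary.{u, v} X n)
    (ω : Dataset X n × (Fin n → Bool) × 𝒜.Seed) : Dataset X n :=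
  𝒜.corrupt ω.1 ω.2.1 ω.2.2

/-- The irreducible error term `2α / (P₁₀ / 3 + α)`. -/
noncomputable def irreducibleOpp (α p : ℝ) : ℝ := 2 * α / (p / 3 + α)

/-- The squared statistical rate `d / n` with its logarithmic factors:
`(d log (2en / d) + log (1 / δ)) / n` (where `d log (2en / d) = 0` for `d = 0`). -/
noncomputable def logRate (d : ℕ) (δ n : ℝ) : ℝ :=
  (d * Real.log (2 * Real.exp 1 * n / d) + Real.log (1 / δ)) / n

/-- The excess error `3α + 2 lam Δ + C (√(d/n) + lam √(d/(p n)))`, the two rates carrying their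
logarithmic factors. -/
noncomputable def oppExcess (C α lam p : ℝ) (d n : ℕ) (δ : ℝ) : ℝ :=
  3 * α + lam * (2 * irreducibleOpp α p) +
    C * (Real.sqrt (logRate d δ n) + lam * Real.sqrt (logRate d δ n / p))

end FairLearning

namespace FairLearning

/-! ### Growth of a hypothesis class -/

/-! The examples paired with their marks form an i.i.d. sample from the product `P.prod (markLaw
α)`, and the adversary can alter only the points whose mark is `true`. It therefore suffices to find
a `GoodSample` event, depending on the marked sample alone, on which every admissible corruption
leaves the empirical objective uniformly close to the true one. The minimality of the learner then
costs twice that distance, and no measurability of the adversary is needed.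

On the good event at most `3/2 * n * α` points are marked, so the risk moves by at most `3α/2`. In
group `a`, the unmarked points give a ratio whose target is exactly the true positive rate, because
marks are independent of examples. If the corrupted data contain `k_a` marked points in the group,
next to `c_a` unmarked ones, the ratio moves by at most `k_a / (c_a + k_a)`. Both groups share one
budget `k_0 + k_1`, and `x / (c + x)` is concave, so an even split is the worst case; this is
`shift_le_irreducibleOpp`, which yields the irreducible term.

The statistical terms come from `measure_uniform_deviation_le`: ghost sample, random swaps,
Hoeffding and Sauer-Shelah. All sets counted lie in a set `G`, and the variance proxy is the number
of hits of `G` rather than `n`. For the unmarked groups this gives deviations of order `√(n P₁₀)`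
relative to counts of order `n P₁₀`, hence the rate `√(d / (P₁₀ n))`. -/

theorem Shatters.card_le {X : Type u} {H : Set (Classifier X)} {d : ℕ} (hd : vcDim H = d)
    {s : Finset X} (hs : Shatters H s) : s.card ≤ d := by
  have h : (s.card : ℕ∞) ≤ vcDim H :=
    le_iSup₂ (f := fun (s : Finset X) (_ : Shatters H s) => (s.card : ℕ∞)) s hs
  rw [hd] at h
  exact_mod_cast h

/-- A class of dimension zero has at most one member. -/
theorem subsingleton_of_vcDim_eq_zero {X : Type u} {H : Set (Classifier X)}
    (hd : vcDim H = (0 : ℕ)) : H.Subsingleton := by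
  classical
  intro h hh g hg
  funext x
  by_contra hne
  have key : ∀ c : Bool, ∃ f ∈ H, f x = c := by
    intro c
    by_cases hc : h x = c
    · exact ⟨h, hh, hc⟩
    · refine ⟨g, hg, ?_⟩
      revert hne hc
      generalize h x = p
      generalize g x = q
      cases p <;> cases q <;> cases c <;> simp
  have hs : Shatters H {x} := by
    intro t _
    obtain ⟨f, hf, hfx⟩ := key (decide (x ∈ t))
    exact ⟨f, hf, by simp [hfx]⟩
  have := hs.card_le hd
  simp at this

/-- The set of the labellings of the points `x i` by members of `H`. -/
def patterns {X : Type u} (H : Set (Classifier X)) {ι : Type*} (x : ι → X) : Set (ι → Bool) :=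
  {b | ∃ h ∈ H, ∀ i, h (x i) = b i}

/-- With `r = d / m ≤ 1`, weighting the `k`-th term by `r ^ k ≥ r ^ d` turns the sum into part of
the binomial expansion of `(1 + r) ^ m ≤ exp d`. -/
theorem sum_choose_le_rpow {m d : ℕ} (hd : 0 < d) (hdm : d ≤ m) :
    ((∑ k ∈ Finset.Iic d, m.choose k : ℕ) : ℝ) ≤ (Real.exp 1 * m / d) ^ d := by
  have hd' : (0 : ℝ) < d := by exact_mod_cast hd
  have hm' : (0 : ℝ) < m := by exact_mod_cast hd.trans_le hdm
  set r : ℝ := d / m with hr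
  have hr0 : 0 < r := by positivity
  have hr1 : r ≤ 1 := by
    rw [hr, div_le_one hm']
    exact_mod_cast hdm
  have h1 : r ^ d * ((∑ k ∈ Finset.Iic d, m.choose k : ℕ) : ℝ) ≤ Real.exp d := by
    calc r ^ d * ((∑ k ∈ Finset.Iic d, m.choose k : ℕ) : ℝ)
        = ∑ k ∈ Finset.Iic d, r ^ d * (m.choose k : ℝ) := by
          rw [Nat.cast_sum, Finset.mul_sum]
      _ ≤ ∑ k ∈ Finset.Iic d, r ^ k * (m.choose k : ℝ) := by
          refine Finset.sum_le_sum fun k hk => ?_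
          have := pow_le_pow_of_le_one hr0.le hr1 (Finset.mem_Iic.1 hk)
          gcongr
      _ ≤ ∑ k ∈ Finset.range (m + 1), r ^ k * (m.choose k : ℝ) := by
          refine Finset.sum_le_sum_of_subset_of_nonneg ?_ fun k _ _ => by positivity
          intro k hk
          simp only [Finset.mem_Iic, Finset.mem_range] at *
          omega
      _ = (r + 1) ^ m := by
          rw [add_pow]
          simp
      _ ≤ (Real.exp r) ^ m := by
          gcongr
          exact Real.add_one_le_exp r
      _ = Real.exp d := by
          rw [← Real.exp_nat_mul, hr]
          congr 1
          field_simp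
  have h2 : (Real.exp 1 * m / d) ^ d = Real.exp d / r ^ d := by
    rw [hr, div_pow, div_pow, mul_pow, ← Real.exp_nat_mul]
    field_simp
  rw [h2, le_div_iff₀ (by positivity)]
  linarith

/-- The Sauer-Shelah bound for the number of labellings. -/
theorem ncard_patterns_le {X : Type u} {H : Set (Classifier X)} {d : ℕ} (hd : vcDim H = d)
    (hd0 : 0 < d) {ι : Type*} [Fintype ι] (hι : d ≤ Fintype.card ι) (x : ι → X) :
    ((patterns H x).ncard : ℝ) ≤ (Real.exp 1 * Fintype.card ι / d) ^ d := by
  classical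
  let φ : (ι → Bool) → Finset ι := fun b => Finset.univ.filter fun i => b i = true
  have hφ : Function.Injective φ := by
    intro b c hbc
    funext i
    have := congrArg (fun s => i ∈ s) hbc
    simp only [φ, Finset.mem_filter, Finset.mem_univ, true_and, eq_iff_iff] at this
    exact Bool.eq_iff_iff.2 this
  let 𝒜 : Finset (Finset ι) := (patterns H x).toFinset.image φ
  have hcard : 𝒜.card = (patterns H x).ncard := by
    rw [Finset.card_image_of_injective _ hφ, Set.ncard_eq_toFinset_card']
  have hvc : 𝒜.vcDim ≤ d := by
    refine Finset.sup_le fun s hs => ?_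
    have hs' := Finset.mem_shatterer.1 hs
    have hx : ∀ t ⊆ s, ∃ h ∈ H, ∀ i ∈ s, h (x i) = true ↔ i ∈ t := by
      intro t ht
      obtain ⟨w, hw, hst⟩ := hs' ht
      obtain ⟨b, hb, rfl⟩ := Finset.mem_image.1 hw
      obtain ⟨h, hh, hhb⟩ := Set.mem_toFinset.1 hb
      refine ⟨h, hh, fun i hi => ?_⟩
      rw [hhb, ← hst]
      simp [φ, hi]
    -- The tuple may repeat points, but two indices with the same point cannot be labelled
    -- differently. A shattered index set thus gives a shattered set of inputs of equal size.
    have hinj : Set.InjOn x s := by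
      intro i hi j hj hij
      obtain ⟨h, -, hh⟩ := hx {i} (by simpa using hi)
      have h1 := (hh i hi).2 (by simp)
      rw [hij] at h1
      exact (Finset.mem_singleton.1 ((hh j hj).1 h1)).symm
    have : Shatters H (s.image x) := by
      intro t ht
      obtain ⟨h, hh, hhs⟩ := hx (s.filter fun i => x i ∈ t) (Finset.filter_subset _ _)
      refine ⟨h, hh, fun y hy => ?_⟩
      obtain ⟨i, hi, rfl⟩ := Finset.mem_image.1 hy
      rw [hhs i hi]
      simp [hi]
    have h := this.card_le hd
    rwa [Finset.card_image_of_injOn hinj] at h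
  have h1 : (patterns H x).ncard ≤ ∑ k ∈ Finset.Iic d, (Fintype.card ι).choose k := by
    rw [← hcard]
    refine (Finset.card_le_card_shatterer _).trans (Finset.card_shatterer_le_sum_vcDim.trans ?_)
    exact Finset.sum_le_sum_of_subset (Finset.Iic_subset_Iic.2 hvc)
  exact le_trans (by exact_mod_cast h1) (sum_choose_le_rpow hd0 hι)

/-! ### Random signs -/

/-- The sign attached to a bit. -/
def bitSign (c : Bool) : ℝ := if c then -1 else 1

/-- The sum over sign vectors factorizes over coordinates, and each factor is `2 cosh (l a_i)`,
where `cosh x ≤ exp (x² / 2)`. -/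
theorem sum_exp_signed_le {n : ℕ} (a : Fin n → ℝ) (l : ℝ) :
    ∑ σ : Fin n → Bool, Real.exp (l * ∑ i, bitSign (σ i) * a i) ≤
      2 ^ n * Real.exp (l ^ 2 * (∑ i, a i ^ 2) / 2) := by
  have h1 : ∀ σ : Fin n → Bool, Real.exp (l * ∑ i, bitSign (σ i) * a i) =
      ∏ i, Real.exp (l * (bitSign (σ i) * a i)) := by
    intro σ
    rw [← Real.exp_sum, Finset.mul_sum]
  simp_rw [h1]
  rw [← Fintype.prod_sum (fun i c => Real.exp (l * (bitSign c * a i)))]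
  have h2 : ∀ i, ∑ c : Bool, Real.exp (l * (bitSign c * a i)) ≤
      2 * Real.exp (l ^ 2 * a i ^ 2 / 2) := by
    intro i
    have h := Real.cosh_le_exp_half_sq (l * a i)
    rw [Real.cosh_eq] at h
    simp only [Fintype.sum_bool, bitSign]
    simp only [if_true, Bool.false_eq_true, if_false, one_mul, neg_mul, mul_neg]
    rw [mul_pow] at h
    linarith
  calc ∏ i, ∑ c : Bool, Real.exp (l * (bitSign c * a i))
      ≤ ∏ i, (2 * Real.exp (l ^ 2 * a i ^ 2 / 2)) :=
        Finset.prod_le_prod (fun i _ => by positivity) fun i _ => h2 i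
    _ = 2 ^ n * Real.exp (l ^ 2 * (∑ i, a i ^ 2) / 2) := by
        rw [Finset.prod_mul_distrib, ← Real.exp_sum, Finset.mul_sum, Finset.sum_div]
        simp

/-- Hoeffding's inequality for a signed sum, as a count of sign vectors. -/
theorem card_signed_gt_le {n : ℕ} (a : Fin n → ℝ) {s V : ℝ} (hs : 0 ≤ s) (hV : 0 < V)
    (haV : ∑ i, a i ^ 2 ≤ V) :
    ((Finset.univ.filter fun σ : Fin n → Bool => s < ∑ i, bitSign (σ i) * a i).card : ℝ) ≤
      2 ^ n * Real.exp (-(s ^ 2 / (2 * V))) := by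
  -- This value minimizes the Chernoff exponent `l² V / 2 - l s`.
  set l := s / V with hl
  have hl0 : 0 ≤ l := by positivity
  have h1 : ((Finset.univ.filter fun σ : Fin n → Bool =>
      s < ∑ i, bitSign (σ i) * a i).card : ℝ) * Real.exp (l * s) ≤
      2 ^ n * Real.exp (l ^ 2 * V / 2) := by
    calc _ = ∑ σ ∈ Finset.univ.filter fun σ : Fin n → Bool =>
          s < ∑ i, bitSign (σ i) * a i, Real.exp (l * s) := by simp
      _ ≤ ∑ σ ∈ Finset.univ.filter fun σ : Fin n → Bool =>
          s < ∑ i, bitSign (σ i) * a i, Real.exp (l * ∑ i, bitSign (σ i) * a i) := by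
          refine Finset.sum_le_sum fun σ hσ => ?_
          have := (Finset.mem_filter.1 hσ).2
          gcongr
      _ ≤ ∑ σ : Fin n → Bool, Real.exp (l * ∑ i, bitSign (σ i) * a i) :=
          Finset.sum_le_sum_of_subset_of_nonneg (Finset.filter_subset _ _)
            fun _ _ _ => by positivity
      _ ≤ _ := (sum_exp_signed_le a l).trans (by gcongr)
  have h2 : -(s ^ 2 / (2 * V)) = l ^ 2 * V / 2 - l * s := by
    rw [hl]
    field_simp
    ring
  rw [h2, Real.exp_sub, ← mul_div_assoc, le_div_iff₀ (by positivity)]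
  exact h1

theorem card_abs_signed_gt_le {n : ℕ} (a : Fin n → ℝ) {s V : ℝ} (hs : 0 ≤ s) (hV : 0 < V)
    (haV : ∑ i, a i ^ 2 ≤ V) :
    ((Finset.univ.filter fun σ : Fin n → Bool => s < |∑ i, bitSign (σ i) * a i|).card : ℝ) ≤
      2 ^ n * (2 * Real.exp (-(s ^ 2 / (2 * V)))) := by
  classical
  have h1 := card_signed_gt_le a hs hV haV
  have h2 := card_signed_gt_le (fun i => - a i) hs hV (by simpa using haV)
  have h3 : (Finset.univ.filter fun σ : Fin n → Bool => s < |∑ i, bitSign (σ i) * a i|) ⊆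
      (Finset.univ.filter fun σ : Fin n → Bool => s < ∑ i, bitSign (σ i) * a i) ∪
      (Finset.univ.filter fun σ : Fin n → Bool => s < ∑ i, bitSign (σ i) * (fun i => - a i) i) := by
    intro σ hσ
    simpa [lt_abs, Finset.sum_neg_distrib] using hσ
  have h4 := (Finset.card_le_card h3).trans (Finset.card_union_le _ _)
  have h5 := (Nat.cast_le (α := ℝ)).2 h4
  push_cast at h5
  linarith

/-! ### Tails of the number of sample points in a set -/

/-- The number of the points of the sample `z` that lie in `F`. -/
noncomputable def hits {Z : Type*} {n : ℕ} (F : Set Z) (z : Fin n → Z) : ℝ :=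
  ∑ i, F.indicator (fun _ => (1 : ℝ)) (z i)

section Tails

variable {Z : Type*} [MeasurableSpace Z] (Q : Measure Z) [IsProbabilityMeasure Q] {n : ℕ}
  {F : Set Z}

theorem measurable_hits (hF : MeasurableSet F) :
    Measurable (hits F : (Fin n → Z) → ℝ) :=
  Finset.measurable_sum _ fun i _ =>
    (measurable_const.indicator hF).comp (measurable_pi_apply i)

/-- The exponential of `s` times an indicator is affine in the indicator; then `1 + x ≤ exp x`. No
sign of `s` is assumed, so both tails follow. -/
theorem integral_exp_indicator_le (hF : MeasurableSet F) (s : ℝ) :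
    ∫ z, Real.exp (s * F.indicator (fun _ => (1 : ℝ)) z) ∂Q ≤
      Real.exp (Q.real F * (Real.exp s - 1)) := by
  have h1 : (fun z => Real.exp (s * F.indicator (fun _ => (1 : ℝ)) z)) =
      fun z => 1 + F.indicator (fun _ => Real.exp s - 1) z := by
    funext z
    by_cases hz : z ∈ F <;> simp [hz]
  rw [h1, integral_add (integrable_const _) ((integrable_const _).indicator hF),
    integral_indicator_const _ hF]
  simp only [integral_const, probReal_univ, smul_eq_mul, one_mul]
  have := Real.add_one_le_exp (Q.real F * (Real.exp s - 1))
  linarith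

/-- The exponential Markov inequality for the number of hits. -/
theorem measure_hits_exp_le (hF : MeasurableSet F) (s r : ℝ) :
    (Measure.pi fun _ : Fin n => Q) {z | s * r ≤ s * hits F z} ≤
      ENNReal.ofReal (Real.exp (n * Q.real F * (Real.exp s - 1) - s * r)) := by
  set μ := Measure.pi fun _ : Fin n => Q
  let f : (Fin n → Z) → ℝ := fun z => ∏ i, Real.exp (s * F.indicator (fun _ => (1 : ℝ)) (z i))
  have hf : ∀ z, f z = Real.exp (s * hits F z) := by
    intro z
    rw [hits, Finset.mul_sum, Real.exp_sum]
  have hint1 : Integrable (fun z => Real.exp (s * F.indicator (fun _ => (1 : ℝ)) z)) Q := by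
    refine Integrable.of_bound (C := Real.exp |s|) ?_ ?_
    · exact (Real.measurable_exp.comp
        ((measurable_const.indicator hF).const_mul s)).aestronglyMeasurable
    · refine Filter.Eventually.of_forall fun z => ?_
      rw [Real.norm_eq_abs, Real.abs_exp]
      gcongr
      by_cases hz : z ∈ F <;> simp [hz, le_abs_self]
  have hint : Integrable f μ := Integrable.fintype_prod (𝕜 := ℝ)
    (f := fun (_ : Fin n) z => Real.exp (s * F.indicator (fun _ => (1 : ℝ)) z)) fun _ => hint1
  have hval : ∫ z, f z ∂μ ≤ Real.exp (n * Q.real F * (Real.exp s - 1)) := by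
    have h := integral_fintype_prod_eq_pow (ι := Fin n) (𝕜 := ℝ) (μ := Q)
      (fun z => Real.exp (s * F.indicator (fun _ => (1 : ℝ)) z))
    calc ∫ z, f z ∂μ = _ := h
      _ ≤ (Real.exp (Q.real F * (Real.exp s - 1))) ^ Fintype.card (Fin n) := by
        gcongr
        exact integral_exp_indicator_le Q hF s
      _ = _ := by
        rw [← Real.exp_nat_mul, Fintype.card_fin, mul_assoc]
  have hm := mul_meas_ge_le_integral_of_nonneg (μ := μ) (f := f)
    (Filter.Eventually.of_forall fun z => by rw [hf]; positivity) hint (Real.exp (s * r))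
  have hset : {z | Real.exp (s * r) ≤ f z} = {z | s * r ≤ s * hits F z} := by
    ext z
    simp [hf]
  rw [hset] at hm
  rw [← ofReal_measureReal]
  refine ENNReal.ofReal_le_ofReal ?_
  rw [Real.exp_sub, le_div_iff₀ (by positivity), mul_comm]
  exact hm.trans hval

theorem measure_hits_ge_three_halves_le (hF : MeasurableSet F) :
    (Measure.pi fun _ : Fin n => Q) {z | 3 / 2 * (n * Q.real F) ≤ hits F z} ≤
      ENNReal.ofReal (Real.exp (-(n * Q.real F / 12))) := by
  -- With `s = 2/5` and `exp s ≤ 3/2`, the exponent per expected hit is at most `1/2 - 3/5 = -1/10`,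
  -- below `-1/12`.
  have h := measure_hits_exp_le Q (n := n) hF (2 / 5) (3 / 2 * (n * Q.real F))
  have he : Real.exp (2 / 5) ≤ 3 / 2 := by
    have h5 := Real.exp_one_lt_d9
    have h2 : (Real.exp (2 / 5)) ^ 5 = Real.exp 1 ^ 2 := by
      rw [← Real.exp_nat_mul, ← Real.exp_nat_mul]
      norm_num
    by_contra hc
    push Not at hc
    have h3 : (3 / 2 : ℝ) ^ 5 < Real.exp (2 / 5) ^ 5 := by gcongr
    have h4 : Real.exp 1 ^ 2 < (2.7182818286 : ℝ) ^ 2 := by gcongr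
    rw [h2] at h3
    norm_num at h3 h4
    linarith
  refine le_trans (le_of_eq ?_) (h.trans (ENNReal.ofReal_le_ofReal (Real.exp_le_exp.2 ?_)))
  · congr 1
    ext z
    simp only [Set.mem_ofPred_eq]
    constructor <;> intro h <;> linarith
  · have : 0 ≤ n * Q.real F := by positivity
    nlinarith

theorem measure_hits_ge_double_le (hF : MeasurableSet F) :
    (Measure.pi fun _ : Fin n => Q) {z | 2 * (n * Q.real F) ≤ hits F z} ≤
      ENNReal.ofReal (Real.exp (-(n * Q.real F / 3))) := by
  have h := measure_hits_exp_le Q (n := n) hF (Real.log 2) (2 * (n * Q.real F))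
  rw [Real.exp_log two_pos] at h
  have hl := Real.log_two_gt_d9
  refine le_trans (le_of_eq ?_) (h.trans (ENNReal.ofReal_le_ofReal (Real.exp_le_exp.2 ?_)))
  · congr 1
    ext z
    simp only [Set.mem_ofPred_eq]
    exact (mul_le_mul_iff_right₀ (by linarith)).symm
  · have : 0 ≤ n * Q.real F := by positivity
    nlinarith

theorem measure_hits_le_half_le (hF : MeasurableSet F) :
    (Measure.pi fun _ : Fin n => Q) {z | hits F z ≤ n * Q.real F / 2} ≤
      ENNReal.ofReal (Real.exp (-(n * Q.real F / 8))) := by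
  -- A negative parameter gives the lower tail; the exponent per expected hit is `(log 2 - 1) / 2 <
  -- -1/8`.
  have h := measure_hits_exp_le Q (n := n) hF (-Real.log 2) (n * Q.real F / 2)
  rw [Real.exp_neg, Real.exp_log two_pos] at h
  have hl := Real.log_two_lt_d9
  have hl' := Real.log_two_gt_d9
  refine le_trans (le_of_eq ?_) (h.trans (ENNReal.ofReal_le_ofReal (Real.exp_le_exp.2 ?_)))
  · congr 1
    ext z
    simp only [Set.mem_ofPred_eq, neg_mul, neg_le_neg_iff]
    exact (mul_le_mul_iff_right₀ (by linarith)).symm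
  · have : 0 ≤ n * Q.real F := by positivity
    nlinarith

/-- Chebyshev's inequality for the number of hits. -/
theorem measure_hits_chebyshev (hF : MeasurableSet F) {c : ℝ} (hc : 0 < c) :
    (Measure.pi fun _ : Fin n => Q) {z | c ≤ |hits F z - n * Q.real F|} ≤
      ENNReal.ofReal (n * Q.real F / c ^ 2) := by
  set μ := Measure.pi fun _ : Fin n => Q
  have hmem : MemLp (F.indicator fun _ => (1 : ℝ)) 2 Q := memLp_indicator_const 2 hF 1 (by simp)
  have hfun : (hits F : (Fin n → Z) → ℝ) =
      ∑ i : Fin n, fun z : Fin n → Z => F.indicator (fun _ => (1 : ℝ)) (z i) := by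
    funext z
    simp [hits]
  have hmem' : MemLp (hits F : (Fin n → Z) → ℝ) 2 μ := by
    rw [hfun]
    exact memLp_finsetSum' _ fun i _ =>
      hmem.comp_measurePreserving (measurePreserving_eval (fun _ : Fin n => Q) i)
  have hmean : ∫ z, hits F z ∂μ = n * Q.real F := by
    have : ∀ i : Fin n, ∫ z, F.indicator (fun _ => (1 : ℝ)) (z i) ∂μ = Q.real F := by
      intro i
      rw [integral_comp_eval (μ := fun _ : Fin n => Q) (i := i) hmem.1,
        integral_indicator_const _ hF]
      simp
    unfold hits
    rw [integral_finsetSum _ fun i _ => ?_]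
    · simp [this]
    · exact (hmem.comp_measurePreserving
        (measurePreserving_eval (fun _ : Fin n => Q) i)).integrable (by norm_num)
  have hvar : ProbabilityTheory.variance (hits F : (Fin n → Z) → ℝ) μ ≤ n * Q.real F := by
    rw [hfun, ProbabilityTheory.variance_sum_pi (fun _ => hmem)]
    have h1 : ProbabilityTheory.variance (F.indicator fun _ => (1 : ℝ)) Q ≤ Q.real F := by
      refine (ProbabilityTheory.variance_le_expectation_sq hmem.1).trans (le_of_eq ?_)
      have : ((F.indicator fun _ => (1 : ℝ)) ^ 2) = F.indicator fun _ => (1 : ℝ) := by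
        funext z
        by_cases hz : z ∈ F <;> simp [hz]
      rw [this, integral_indicator_const _ hF]
      simp
    refine (Finset.sum_le_sum fun _ _ => h1).trans ?_
    simp
  have h := ProbabilityTheory.meas_ge_le_variance_div_sq hmem' hc
  rw [hmean] at h
  exact h.trans (ENNReal.ofReal_le_ofReal (by gcongr))

end Tails

/-! ### Symmetrization -/

section Symmetrization

variable {Z : Type*} {n : ℕ}

/-- The difference of the numbers of hits of `F` in the two halves of a paired sample. -/
noncomputable def hitGap (F : Set Z) (w : Fin n → Z × Z) : ℝ :=
  hits F (fun i => (w i).1) - hits F (fun i => (w i).2)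

/-- Swap the pairs of a paired sample at the indices marked by `σ`. -/
def swapAt (σ : Fin n → Bool) (w : Fin n → Z × Z) : Fin n → Z × Z :=
  fun i => if σ i then (w i).swap else w i

theorem hitGap_swapAt (F : Set Z) (σ : Fin n → Bool) (w : Fin n → Z × Z) :
    hitGap F (swapAt σ w) = ∑ i, bitSign (σ i) *
      (F.indicator (fun _ => (1 : ℝ)) (w i).1 - F.indicator (fun _ => (1 : ℝ)) (w i).2) := by
  rw [hitGap, hits, hits, ← Finset.sum_sub_distrib]
  refine Finset.sum_congr rfl fun i _ => ?_
  by_cases h : σ i <;> simp [swapAt, bitSign, h]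

/-- The pooled count is invariant under swaps, so conditioning on it does not disturb the random
signs. -/
theorem hits_add_hits_swapAt (F : Set Z) (σ : Fin n → Bool) (w : Fin n → Z × Z) :
    hits F (fun i => (swapAt σ w i).1) + hits F (fun i => (swapAt σ w i).2) =
      hits F (fun i => (w i).1) + hits F (fun i => (w i).2) := by
  simp only [hits, ← Finset.sum_add_distrib]
  refine Finset.sum_congr rfl fun i _ => ?_
  by_cases h : σ i <;> simp [swapAt, h, add_comm]

theorem hits_congr {m : ℕ} {F F' : Set Z} {z : Fin m → Z} (h : ∀ i, z i ∈ F ↔ z i ∈ F') :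
    hits F z = hits F' z := by
  classical
  refine Finset.sum_congr rfl fun i _ => ?_
  simp only [Set.indicator_apply, h]

/-- A family of sets induces at most `N` labellings on every paired sample: it has at most `N`
representatives with the same traces. -/
def TraceBound (𝓕 : Set (Set Z)) (n N : ℕ) : Prop :=
  ∀ w : Fin n → Z × Z, ∃ T : Finset (Set Z), (T : Set (Set Z)) ⊆ 𝓕 ∧ T.card ≤ N ∧
    ∀ F ∈ 𝓕, ∃ D ∈ T, ∀ i, ((w i).1 ∈ F ↔ (w i).1 ∈ D) ∧ ((w i).2 ∈ F ↔ (w i).2 ∈ D)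

/-- Few sign vectors swap a given paired sample into one with a large gap. -/
theorem card_swapAt_hitGap_gt_le {𝓕 : Set (Set Z)} {G : Set Z} {N : ℕ} (hN : TraceBound 𝓕 n N)
    (hG : ∀ F ∈ 𝓕, F ⊆ G) {s V : ℝ} (hs : 0 ≤ s) (hV : 0 < V) (w : Fin n → Z × Z)
    (hw : hits G (fun i => (w i).1) + hits G (fun i => (w i).2) ≤ V) :
    ((Set.ncard {σ : Fin n → Bool | ∃ F ∈ 𝓕, s < |hitGap F (swapAt σ w)|} : ℕ) : ℝ) ≤
      2 ^ n * (2 * N * Real.exp (-(s ^ 2 / (2 * V)))) := by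
  classical
  obtain ⟨T, hT, hcard, hrep⟩ := hN w
  let A : Set Z → Finset (Fin n → Bool) := fun F =>
    Finset.univ.filter fun σ => s < |hitGap F (swapAt σ w)|
  have hsub : {σ : Fin n → Bool | ∃ F ∈ 𝓕, s < |hitGap F (swapAt σ w)|} ⊆
      (T.biUnion A : Finset _) := by
    rintro σ ⟨F, hF, hσ⟩
    obtain ⟨F', hF', hFF⟩ := hrep F hF
    simp only [A, Finset.coe_biUnion, Set.mem_iUnion, Finset.mem_coe, Finset.mem_filter,
      Finset.mem_univ, true_and]
    refine ⟨F', hF', ?_⟩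
    have h : hitGap F (swapAt σ w) = hitGap F' (swapAt σ w) := by
      unfold hitGap
      congr 1 <;>
      · refine hits_congr fun i => ?_
        by_cases h : σ i <;> simp [swapAt, h, hFF i]
    rwa [← h]
  have hA : ∀ F ∈ T, ((A F).card : ℝ) ≤ 2 ^ n * (2 * Real.exp (-(s ^ 2 / (2 * V)))) := by
    intro F hF
    -- A pair contributes to the variance only if one of its points lies in `F ⊆ G`. This localizes
    -- the bound to the hits of `G`.
    have hle : ∑ i, (F.indicator (fun _ => (1 : ℝ)) (w i).1 -
        F.indicator (fun _ => (1 : ℝ)) (w i).2) ^ 2 ≤ V := by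
      refine le_trans ?_ hw
      simp only [hits, ← Finset.sum_add_distrib]
      refine Finset.sum_le_sum fun i _ => ?_
      have h1 : (w i).1 ∈ F → (w i).1 ∈ G := fun h => hG F (hT hF) h
      have h2 : (w i).2 ∈ F → (w i).2 ∈ G := fun h => hG F (hT hF) h
      simp only [Set.indicator_apply]
      split_ifs <;> first | tauto | norm_num
    have h := card_abs_signed_gt_le _ hs hV hle
    simpa only [A, hitGap_swapAt] using h
  calc ((Set.ncard {σ : Fin n → Bool | ∃ F ∈ 𝓕, s < |hitGap F (swapAt σ w)|} : ℕ) : ℝ)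
      ≤ ((T.biUnion A).card : ℝ) := by
        have := Set.ncard_le_ncard hsub (Finset.finite_toSet _)
        rw [Set.ncard_coe_finset] at this
        exact_mod_cast this
    _ ≤ ∑ F ∈ T, ((A F).card : ℝ) := by exact_mod_cast Finset.card_biUnion_le
    _ ≤ T.card * (2 ^ n * (2 * Real.exp (-(s ^ 2 / (2 * V))))) := by
        refine (Finset.sum_le_sum hA).trans ?_
        simp
    _ ≤ N * (2 ^ n * (2 * Real.exp (-(s ^ 2 / (2 * V))))) := by gcongr
    _ = _ := by ring

variable [MeasurableSpace Z] (Q : Measure Z) [IsProbabilityMeasure Q]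

theorem measurePreserving_swapAt (σ : Fin n → Bool) :
    MeasurePreserving (swapAt σ : (Fin n → Z × Z) → Fin n → Z × Z)
      (Measure.pi fun _ => Q.prod Q) (Measure.pi fun _ => Q.prod Q) := by
  refine measurePreserving_pi (fun _ : Fin n => Q.prod Q) (fun _ => Q.prod Q)
    (f := fun i p => if σ i then p.swap else p) fun i => ?_
  by_cases h : σ i
  · simpa [h] using Measure.measurePreserving_swap (μ := Q) (ν := Q)
  · simp only [h]
    exact MeasurePreserving.id (Q.prod Q)

/-- An event of a paired sample that few swaps produce has small probability. -/
theorem measure_le_of_ncard_swapAt_le {E : Set (Fin n → Z × Z)}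
    (hE : NullMeasurableSet E (Measure.pi fun _ => Q.prod Q)) {c : ℝ}
    (hc : ∀ w, ((Set.ncard {σ : Fin n → Bool | swapAt σ w ∈ E} : ℕ) : ℝ) ≤ 2 ^ n * c) :
    (Measure.pi fun _ : Fin n => Q.prod Q) E ≤ ENNReal.ofReal c := by
  classical
  set μ := Measure.pi fun _ : Fin n => Q.prod Q
  have hmp := fun σ : Fin n → Bool => measurePreserving_swapAt Q σ
  have hEσ : ∀ σ : Fin n → Bool, NullMeasurableSet (swapAt σ ⁻¹' E) μ := fun σ =>
    hE.preimage (hmp σ).quasiMeasurePreserving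
  -- Every swap preserves the law, so averaging over all swaps leaves the probability unchanged;
  -- pointwise, the average is the proportion of swaps landing in `E`.
  have h1 : (2 : ENNReal) ^ n * μ E =
      ∫⁻ w, ∑ σ : Fin n → Bool, (swapAt σ ⁻¹' E).indicator (fun _ => 1) w ∂μ := by
    rw [lintegral_finsetSum' _ fun σ _ => aemeasurable_const.indicator₀ (hEσ σ)]
    have : ∀ σ : Fin n → Bool, ∫⁻ w, (swapAt σ ⁻¹' E).indicator (fun _ => 1) w ∂μ = μ E := by
      intro σ
      rw [← (hmp σ).measure_preimage hE]
      exact lintegral_indicator_one₀ (hEσ σ)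
    simp [this]
  have h2 : ∫⁻ w, ∑ σ : Fin n → Bool, (swapAt σ ⁻¹' E).indicator (fun _ => 1) w ∂μ ≤
      2 ^ n * ENNReal.ofReal c := by
    calc _ ≤ ∫⁻ _, 2 ^ n * ENNReal.ofReal c ∂μ := by
          refine lintegral_mono fun w => ?_
          have h3 : ∑ σ : Fin n → Bool, (swapAt σ ⁻¹' E).indicator (fun _ => (1 : ENNReal)) w =
              (Set.ncard {σ : Fin n → Bool | swapAt σ w ∈ E} : ℕ) := by
            rw [Set.ncard_eq_toFinset_card']
            simp [Set.indicator_apply]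
          have h4 : (2 : ENNReal) ^ n * ENNReal.ofReal c = ENNReal.ofReal (2 ^ n * c) := by
            rw [ENNReal.ofReal_mul (by positivity), ENNReal.ofReal_pow (by norm_num)]
            simp
          simp only
          rw [h3, h4, ← ENNReal.ofReal_natCast]
          exact ENNReal.ofReal_le_ofReal (hc w)
      _ = _ := by simp
  rw [← h1] at h2
  exact (ENNReal.mul_le_mul_iff_right (by positivity) (by simp)).1 h2

/-- Passage to a ghost sample. -/
theorem measure_deviation_le_two_mul_hitGap {𝓕 : Set (Set Z)} {G : Set Z}
    (hm : ∀ F ∈ 𝓕, MeasurableSet F) (hG : ∀ F ∈ 𝓕, F ⊆ G) {t : ℝ} (ht : 0 < t)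
    (htp : 8 * (n * Q.real G) ≤ t ^ 2) :
    (Measure.pi fun _ : Fin n => Q) {z | ∃ F ∈ 𝓕, t < |hits F z - n * Q.real F|} ≤
      2 * (Measure.pi fun _ : Fin n => Q.prod Q) {w | ∃ F ∈ 𝓕, t / 2 < |hitGap F w|} := by
  set μ := Measure.pi fun _ : Fin n => Q
  let E : Set ((Fin n → Z) × (Fin n → Z)) :=
    {q | ∃ F ∈ 𝓕, t / 2 < |hits F q.1 - hits F q.2|}
  have hpair : (Measure.pi fun _ : Fin n => Q.prod Q) {w | ∃ F ∈ 𝓕, t / 2 < |hitGap F w|} =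
      (μ.prod μ) E := by
    have h := measurePreserving_arrowProdEquivProdArrow Z Z (Fin n) (fun _ => Q) (fun _ => Q)
    exact h.measure_preimage_equiv E
  -- A measurable hull of `E` makes the section measures measurable, as Markov's inequality
  -- requires.
  set M := toMeasurable (μ.prod μ) E
  have hM : MeasurableSet M := measurableSet_toMeasurable _ _
  have hsub : {z | ∃ F ∈ 𝓕, t < |hits F z - n * Q.real F|} ⊆
      {z | (2 : ENNReal)⁻¹ ≤ μ (Prod.mk z ⁻¹' M)} := by
    rintro z ⟨F, hF, hz⟩
    let A : Set (Fin n → Z) := {z' | t / 2 ≤ |hits F z' - n * Q.real F|}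
    have hA : MeasurableSet A :=
      measurableSet_le measurable_const
        (((measurable_hits (hm F hF)).sub measurable_const).abs)
    -- The hypothesis `8 n Q(G) ≤ t²` is what makes Chebyshev at scale `t / 2` give one half.
    have hAle : μ A ≤ 2⁻¹ := by
      refine (measure_hits_chebyshev Q (hm F hF) (half_pos ht)).trans ?_
      have h2 : (2 : ENNReal)⁻¹ = ENNReal.ofReal (2⁻¹) := by
        rw [ENNReal.ofReal_inv_of_pos two_pos]
        simp
      rw [h2]
      refine ENNReal.ofReal_le_ofReal ?_
      have hFG : Q.real F ≤ Q.real G := measureReal_mono (hG F hF)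
      rw [div_le_iff₀ (by positivity)]
      have : (n : ℝ) * Q.real F ≤ n * Q.real G := by gcongr
      nlinarith
    have hAc : (2 : ENNReal)⁻¹ ≤ μ Aᶜ := by
      rw [prob_compl_eq_one_sub hA]
      refine le_trans ?_ (tsub_le_tsub_left hAle 1)
      rw [ENNReal.one_sub_inv_two]
    refine hAc.trans (measure_mono fun z' hz' => subset_toMeasurable _ _ ?_)
    refine ⟨F, hF, ?_⟩
    have h1 : |hits F z' - n * Q.real F| < t / 2 := not_le.1 hz'
    have h2 := abs_sub_abs_le_abs_sub (hits F z - n * Q.real F) (hits F z' - n * Q.real F)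
    rw [sub_sub_sub_cancel_right] at h2
    simp only
    linarith
  have hmark := mul_meas_ge_le_lintegral (μ := μ) (measurable_measure_prodMk_left (ν := μ) hM) 2⁻¹
  rw [← Measure.prod_apply hM, measure_toMeasurable] at hmark
  rw [hpair]
  calc μ {z | ∃ F ∈ 𝓕, t < |hits F z - n * Q.real F|}
      ≤ μ {z | (2 : ENNReal)⁻¹ ≤ μ (Prod.mk z ⁻¹' M)} := measure_mono hsub
    _ = 2 * (2⁻¹ * μ {z | (2 : ENNReal)⁻¹ ≤ μ (Prod.mk z ⁻¹' M)}) := by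
        rw [← mul_assoc, ENNReal.mul_inv_cancel (by simp) (by simp), one_mul]
    _ ≤ 2 * (μ.prod μ) E := by gcongr

/-- Uniform deviations over a family of subsets of `G`, on the scale of `n * Q G`. -/
theorem measure_uniform_deviation_le {𝓕 : Set (Set Z)} {G : Set Z} {N : ℕ}
    (hm : ∀ F ∈ 𝓕, MeasurableSet F) (hG : ∀ F ∈ 𝓕, F ⊆ G) (hGm : MeasurableSet G)
    (hN : TraceBound 𝓕 n N) {t : ℝ} (ht : 0 < t) (hp : 0 < n * Q.real G)
    (htp : 8 * (n * Q.real G) ≤ t ^ 2)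
    (hnull : NullMeasurableSet {w | ∃ F ∈ 𝓕, t / 2 < |hitGap F w|}
      (Measure.pi fun _ : Fin n => Q.prod Q)) :
    (Measure.pi fun _ : Fin n => Q) {z | ∃ F ∈ 𝓕, t < |hits F z - n * Q.real F|} ≤
      ENNReal.ofReal (4 * N * Real.exp (-(t ^ 2 / (32 * (n * Q.real G)))) +
        4 * Real.exp (-(n * Q.real G / 3))) := by
  set p := n * Q.real G with hpdef
  set μ₂ := Measure.pi fun _ : Fin n => Q.prod Q
  have hfst : MeasurePreserving (fun (w : Fin n → Z × Z) i => (w i).1) μ₂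
      (Measure.pi fun _ : Fin n => Q) :=
    measurePreserving_pi _ _ (f := fun _ => Prod.fst) fun _ => measurePreserving_fst
  have hsnd : MeasurePreserving (fun (w : Fin n → Z × Z) i => (w i).2) μ₂
      (Measure.pi fun _ : Fin n => Q) :=
    measurePreserving_pi _ _ (f := fun _ => Prod.snd) fun _ => measurePreserving_snd
  let D : Set (Fin n → Z × Z) := {w | ∃ F ∈ 𝓕, t / 2 < |hitGap F w|}
  let W : Set (Fin n → Z × Z) :=
    {w | hits G (fun i => (w i).1) + hits G (fun i => (w i).2) ≤ 4 * p}
  let U : Set (Fin n → Z) := {z | 2 * p ≤ hits G z}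
  have hW : MeasurableSet W := measurableSet_le
    (((measurable_hits hGm).comp hfst.measurable).add ((measurable_hits hGm).comp hsnd.measurable))
    measurable_const
  have hU : MeasurableSet U := measurableSet_le measurable_const (measurable_hits hGm)
  -- On `W` the variance proxy is at most `V = 4 p`. Off `W`, one half has at least `2 p` hits of
  -- `G`, twice the mean, which is rare.
  have hDW : μ₂ (D ∩ W) ≤ ENNReal.ofReal (2 * N * Real.exp (-(t ^ 2 / (32 * p)))) := by
    refine measure_le_of_ncard_swapAt_le Q (hnull.inter hW.nullMeasurableSet) fun w => ?_
    by_cases hw : w ∈ W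
    · have h := card_swapAt_hitGap_gt_le hN hG (half_pos ht).le (V := 4 * p) (by positivity) w hw
      have he : (t / 2) ^ 2 / (2 * (4 * p)) = t ^ 2 / (32 * p) := by
        field_simp
        ring
      rw [he] at h
      refine le_trans ?_ h
      gcongr
      · exact Set.toFinite _
      · exact fun hσ => hσ.1
    · have : {σ : Fin n → Bool | swapAt σ w ∈ D ∩ W} = ∅ := by
        ext σ
        simp only [Set.mem_ofPred_eq, Set.mem_empty_iff_false, iff_false]
        rintro ⟨-, h⟩
        refine hw ?_
        have h' := hits_add_hits_swapAt G σ w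
        exact h'.symm.le.trans h
      rw [this]
      simp only [Set.ncard_empty, Nat.cast_zero]
      positivity
  have hU' := measure_hits_ge_double_le Q (n := n) hGm
  have hD : μ₂ D ≤ ENNReal.ofReal (2 * N * Real.exp (-(t ^ 2 / (32 * p)))) +
      (ENNReal.ofReal (Real.exp (-(p / 3))) + ENNReal.ofReal (Real.exp (-(p / 3)))) := by
    have hcover : D ⊆ (D ∩ W) ∪ ((fun (w : Fin n → Z × Z) i => (w i).1) ⁻¹' U ∪
        (fun (w : Fin n → Z × Z) i => (w i).2) ⁻¹' U) := by
      intro w hw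
      by_cases hwW : w ∈ W
      · exact Or.inl ⟨hw, hwW⟩
      · right
        have h1 : 4 * p < hits G (fun i => (w i).1) + hits G (fun i => (w i).2) := not_le.1 hwW
        by_cases h2 : 2 * p ≤ hits G (fun i => (w i).1)
        · exact Or.inl h2
        · right
          have : 2 * p ≤ hits G (fun i => (w i).2) := by linarith
          exact this
    refine (measure_mono hcover).trans ((measure_union_le _ _).trans (add_le_add hDW ?_))
    refine (measure_union_le _ _).trans (add_le_add ?_ ?_)
    · rw [hfst.measure_preimage hU.nullMeasurableSet]
      exact hU'
    · rw [hsnd.measure_preimage hU.nullMeasurableSet]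
      exact hU'
  refine (measure_deviation_le_two_mul_hitGap Q hm hG ht htp).trans ?_
  refine (mul_le_mul_right hD 2).trans (le_of_eq ?_)
  rw [← ENNReal.ofReal_add (by positivity) (by positivity),
    ← ENNReal.ofReal_add (by positivity) (by positivity)]
  have : (2 : ENNReal) = ENNReal.ofReal 2 := by simp
  rw [this, ← ENNReal.ofReal_mul (by norm_num)]
  congr 1
  ring

end Symmetrization

/-! ### Uniform deviations over a hypothesis class -/

section Traces

variable {Z : Type*} {X : Type u} {n : ℕ}

/-- The part of `G` on which the label given by `h` differs from the label `b`. -/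
def disagreement (π : Z → X) (b : Z → Bool) (G : Set Z) (h : Classifier X) : Set Z :=
  {z | z ∈ G ∧ h (π z) ≠ b z}

/-- The inputs of a paired sample, in one tuple. -/
def pairInputs (π : Z → X) (w : Fin n → Z × Z) : Fin n ⊕ Fin n → X :=
  Sum.elim (fun i => π (w i).1) (fun i => π (w i).2)

theorem traceBound_disagreement (π : Z → X) (b : Z → Bool) (G : Set Z) {H : Set (Classifier X)}
    {d : ℕ} (hd : vcDim H = d) (hd0 : 0 < d) (hdn : d ≤ n + n) :
    TraceBound (disagreement π b G '' H) n ⌊(2 * Real.exp 1 * n / d) ^ d⌋₊ := by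
  classical
  intro w
  have hrep : ∀ c : patterns H (pairInputs π w), ∃ h ∈ H, ∀ k, h (pairInputs π w k) = c.1 k :=
    fun c => c.2
  choose f hfH hf using hrep
  refine ⟨Finset.univ.image fun c => disagreement π b G (f c), ?_, ?_, ?_⟩
  · intro F hF
    simp only [Finset.coe_image, Finset.coe_univ, Set.image_univ, Set.mem_range] at hF
    obtain ⟨c, rfl⟩ := hF
    exact ⟨f c, hfH c, rfl⟩
  · refine Finset.card_image_le.trans (Nat.le_floor ?_)
    have h := ncard_patterns_le hd hd0 (by simpa using hdn) (pairInputs π w)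
    rw [Finset.card_univ, ← Nat.card_eq_fintype_card]
    refine h.trans (le_of_eq ?_)
    simp only [Fintype.card_sum, Fintype.card_fin, Nat.cast_add]
    ring
  · rintro _ ⟨h, hh, rfl⟩
    let c : patterns H (pairInputs π w) := ⟨fun k => h (pairInputs π w k), h, hh, fun _ => rfl⟩
    refine ⟨_, Finset.mem_image_of_mem _ (Finset.mem_univ c), fun i => ⟨?_, ?_⟩⟩
    · have : f c (π (w i).1) = h (π (w i).1) := hf c (.inl i)
      simp [disagreement, this]
    · have : f c (π (w i).2) = h (π (w i).2) := hf c (.inr i)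
      simp [disagreement, this]

end Traces

section UniformDeviation

variable {Z : Type*} [MeasurableSpace Z] (Q : Measure Z) [IsProbabilityMeasure Q] {n : ℕ}

/-- Calibration: `t² = 192 p K` makes the exponent `6 K`. One `K` absorbs the growth bound `N ≤ δ
exp K`, and the remaining `exp (-5 K) ≤ 1/64` brings the term down to `δ / 16`. -/
theorem measure_uniform_deviation_le_of_rate {𝓕 : Set (Set Z)} {G : Set Z} {N : ℕ}
    (hm : ∀ F ∈ 𝓕, MeasurableSet F) (hG : ∀ F ∈ 𝓕, F ⊆ G) (hGm : MeasurableSet G)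
    (hN : TraceBound 𝓕 n N)
    (hnull : ∀ s : ℝ, NullMeasurableSet {w | ∃ F ∈ 𝓕, s < |hitGap F w|}
      (Measure.pi fun _ : Fin n => Q.prod Q))
    {δ K : ℝ} (hδ : 0 < δ) (hδ1 : δ < 1) (hK : 1 ≤ K) (hNK : N ≤ δ * Real.exp K)
    (hp : 8 * Real.log (16 / δ) ≤ n * Q.real G) :
    (Measure.pi fun _ : Fin n => Q)
      {z | ∃ F ∈ 𝓕, Real.sqrt (192 * (n * Q.real G) * K) < |hits F z - n * Q.real F|} ≤
      ENNReal.ofReal (δ / 8) := by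
  set p := n * Q.real G with hpdef
  have hlog : 0 < Real.log (16 / δ) := by
    apply Real.log_pos
    rw [lt_div_iff₀ hδ]
    linarith
  have hp0 : 0 < p := by linarith
  have hsq : Real.sqrt (192 * p * K) ^ 2 = 192 * p * K := Real.sq_sqrt (by positivity)
  refine (measure_uniform_deviation_le Q hm hG hGm hN (Real.sqrt_pos.2 (by positivity)) hp0
    (by rw [hsq]; nlinarith) (hnull _)).trans (ENNReal.ofReal_le_ofReal ?_)
  rw [hsq]
  have h1 : 192 * p * K / (32 * p) = 6 * K := by
    field_simp
    ring
  rw [h1]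
  have h2 : 4 * N * Real.exp (-(6 * K)) ≤ δ / 16 := by
    calc 4 * N * Real.exp (-(6 * K)) ≤ 4 * (δ * Real.exp K) * Real.exp (-(6 * K)) := by gcongr
      _ = 4 * δ * Real.exp (-5 * K) := by
        rw [show -5 * K = K + -(6 * K) by ring, Real.exp_add]
        ring
      _ ≤ 4 * δ * Real.exp (-5) := by
        gcongr
        linarith
      _ ≤ 4 * δ * (1 / 64) := by
        gcongr
        have h3 : Real.exp (-1) < 1 / 2.7 := by
          rw [Real.exp_neg, ← one_div]
          have := Real.exp_one_gt_d9
          gcongr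
          linarith
        have h4 : Real.exp (-5) = Real.exp (-1) ^ 5 := by
          rw [← Real.exp_nat_mul]
          norm_num
        rw [h4]
        calc Real.exp (-1) ^ 5 ≤ (1 / 2.7) ^ 5 := by gcongr
          _ ≤ 1 / 64 := by norm_num
      _ = δ / 16 := by ring
  -- Since `p / 3 ≥ 2 log (16 / δ)`, the exponential is at most `(δ / 16) ^ 2`.
  have h5 : 4 * Real.exp (-(p / 3)) ≤ δ / 16 := by
    have : Real.exp (-(p / 3)) ≤ Real.exp (-(Real.log (16 / δ) + Real.log (16 / δ))) := by
      gcongr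
      linarith
    rw [neg_add, Real.exp_add, Real.exp_neg (Real.log _), Real.exp_log (by positivity),
      inv_div] at this
    nlinarith
  change 4 * N * Real.exp (-(6 * K)) + 4 * Real.exp (-(p / 3)) ≤ δ / 8
  linarith

/-- Deviation of the number of hits of a single set. -/
theorem measure_single_deviation_le {G : Set Z} (hGm : MeasurableSet G) {δ K : ℝ} (hδ : 0 < δ)
    (hδ1 : δ < 1) (hK : 1 ≤ K) (hδK : 1 ≤ δ * Real.exp K)
    (hp : 8 * Real.log (16 / δ) ≤ n * Q.real G) :
    (Measure.pi fun _ : Fin n => Q)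
      {z | Real.sqrt (192 * (n * Q.real G) * K) < |hits G z - n * Q.real G|} ≤
      ENNReal.ofReal (δ / 8) := by
  have h := measure_uniform_deviation_le_of_rate Q (n := n) (𝓕 := {G}) (G := G) (N := 1)
    (by simpa using hGm) (by simp) hGm (fun w => ⟨{G}, by simp⟩) (fun s => ?_) hδ hδ1 hK
    (by simpa using hδK) hp
  · simpa using h
  · refine MeasurableSet.nullMeasurableSet ?_
    simp only [Set.mem_singleton_iff, exists_eq_left]
    refine measurableSet_lt measurable_const (Measurable.abs ?_)
    exact ((measurable_hits hGm).comp (by fun_prop)).sub ((measurable_hits hGm).comp (by fun_prop))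

variable {X : Type u} [MeasurableSpace X]

theorem measurableSet_disagreement {π : Z → X} (hπ : Measurable π) {b : Z → Bool}
    (hb : Measurable b) {G : Set Z} (hG : MeasurableSet G) {h : Classifier X} (hh : Measurable h) :
    MeasurableSet (disagreement π b G h) :=
  hG.inter (measurableSet_eq_fun (hh.comp hπ) hb).compl

/-- Null measurability pulls back only along maps respecting null sets; this carries the assumption
on input tuples over to paired samples. -/
theorem measurePreserving_pairInputs {π : Z → X} (hπ : Measurable π) :
    MeasurePreserving (pairInputs π : (Fin n → Z × Z) → Fin n ⊕ Fin n → X)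
      (Measure.pi fun _ => Q.prod Q) (Measure.pi fun _ => Q.map π) := by
  have : IsProbabilityMeasure (Q.map π) := Measure.isProbabilityMeasure_map hπ.aemeasurable
  have hQ : MeasurePreserving π Q (Q.map π) := ⟨hπ, rfl⟩
  have h1 := measurePreserving_pi (fun _ : Fin n => Q.prod Q)
    (fun _ : Fin n => (Q.map π).prod (Q.map π)) (f := fun _ => Prod.map π π)
    fun _ => hQ.prod hQ
  have h2 := measurePreserving_arrowProdEquivProdArrow X X (Fin n) (fun _ => Q.map π)
    (fun _ => Q.map π)
  have h3 := measurePreserving_sumPiEquivProdPi_symm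
    (X := fun _ : Fin n ⊕ Fin n => X) (fun _ => Q.map π)
  have h := h3.comp (h2.comp h1)
  convert h using 1
  funext w k
  cases k <;> rfl

/-- The event that a given labelling is realized is null measurable for every finite index set. -/
theorem nullMeasurableSet_patterns {ν : Measure X} [IsProbabilityMeasure ν]
    {H : Set (Classifier X)}
    (hH : ∀ (m : ℕ) (c : Fin m → Bool),
      NullMeasurableSet {x : Fin m → X | ∃ h ∈ H, ∀ i, h (x i) = c i} (Measure.pi fun _ => ν))
    {ι : Type*} [Fintype ι] (c : ι → Bool) :
    NullMeasurableSet {x : ι → X | c ∈ patterns H x} (Measure.pi fun _ => ν) := by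
  let e := Fintype.equivFin ι
  have hmp := measurePreserving_piCongrLeft (α := fun _ : Fin (Fintype.card ι) => X)
    (fun _ => ν) e
  have h := (hH _ (fun k => c (e.symm k))).preimage hmp.quasiMeasurePreserving
  convert h using 1
  ext x
  simp only [patterns, Set.mem_ofPred_eq, Set.mem_preimage]
  refine exists_congr fun g => and_congr_right fun _ => ?_
  rw [← e.forall_congr_right]
  refine forall_congr' fun i => ?_
  rw [MeasurableEquiv.coe_piCongrLeft, Equiv.piCongrLeft_apply_apply, e.symm_apply_apply]

/-- The gap depends on `h` only through its `2n` labels, so the possibly uncountable union over `H`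
is a finite union over label patterns. -/
theorem nullMeasurableSet_hitGap {π : Z → X} (hπ : Measurable π) {b : Z → Bool}
    (hb : Measurable b) {G : Set Z} (hG : MeasurableSet G) {H : Set (Classifier X)}
    (hH : ∀ (m : ℕ) (c : Fin m → Bool),
      NullMeasurableSet {x : Fin m → X | ∃ h ∈ H, ∀ i, h (x i) = c i}
        (Measure.pi fun _ => Q.map π)) (s : ℝ) :
    NullMeasurableSet {w | ∃ F ∈ disagreement π b G '' H, s < |hitGap F w|}
      (Measure.pi fun _ : Fin n => Q.prod Q) := by
  classical
  have : IsProbabilityMeasure (Q.map π) := Measure.isProbabilityMeasure_map hπ.aemeasurable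
  let D : Bool → Set Z := fun c => {z | z ∈ G ∧ c ≠ b z}
  have hD : ∀ c, MeasurableSet (D c) := fun c =>
    hG.inter (measurableSet_eq_fun measurable_const hb).compl
  let gap : (Fin n ⊕ Fin n → Bool) → (Fin n → Z × Z) → ℝ := fun c w =>
    ∑ i, (D (c (.inl i))).indicator (fun _ => (1 : ℝ)) (w i).1 -
      ∑ i, (D (c (.inr i))).indicator (fun _ => (1 : ℝ)) (w i).2
  have hgap : ∀ c, Measurable (gap c) := by
    intro c
    refine Measurable.sub ?_ ?_ <;> refine Finset.measurable_sum _ fun i _ => ?_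
    · exact (measurable_const.indicator (hD _)).comp (by fun_prop)
    · exact (measurable_const.indicator (hD _)).comp (by fun_prop)
  have hval : ∀ h w, hitGap (disagreement π b G h) w = gap (fun k => h (pairInputs π w k)) w := by
    intro h w
    simp only [hitGap, hits, gap]
    congr 1
  have hset : {w : Fin n → Z × Z | ∃ F ∈ disagreement π b G '' H, s < |hitGap F w|} =
      ⋃ c : Fin n ⊕ Fin n → Bool,
        (pairInputs π ⁻¹' {x | c ∈ patterns H x}) ∩ {w | s < |gap c w|} := by
    ext w
    simp only [Set.mem_ofPred_eq, Set.mem_iUnion, Set.mem_inter_iff, Set.mem_preimage,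
      Set.exists_mem_image, hval]
    constructor
    · rintro ⟨h, hh, hs⟩
      exact ⟨_, ⟨h, hh, fun _ => rfl⟩, hs⟩
    · rintro ⟨c, ⟨h, hh, hc⟩, hs⟩
      refine ⟨h, hh, ?_⟩
      rwa [show (fun k => h (pairInputs π w k)) = c from funext hc]
  rw [hset]
  refine NullMeasurableSet.iUnion fun c => NullMeasurableSet.inter ?_ ?_
  · exact (nullMeasurableSet_patterns hH c).preimage
      (measurePreserving_pairInputs Q hπ).quasiMeasurePreserving
  · exact (measurableSet_lt measurable_const (hgap c).abs).nullMeasurableSet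

/-- Uniform deviations over a class of finite Vapnik-Chervonenkis dimension. -/
theorem measure_disagreement_deviation_le {π : Z → X} (hπ : Measurable π) {b : Z → Bool}
    (hb : Measurable b) {G : Set Z} (hG : MeasurableSet G) {H : Set (Classifier X)}
    (hHm : ∀ h ∈ H, Measurable h)
    (hH : ∀ (m : ℕ) (c : Fin m → Bool),
      NullMeasurableSet {x : Fin m → X | ∃ h ∈ H, ∀ i, h (x i) = c i}
        (Measure.pi fun _ => Q.map π))
    {d : ℕ} (hd : vcDim H = d) (hd0 : 0 < d) (hdn : d ≤ n + n)
    {δ K : ℝ} (hδ : 0 < δ) (hδ1 : δ < 1) (hK : 1 ≤ K)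
    (hNK : (2 * Real.exp 1 * n / d) ^ d ≤ δ * Real.exp K)
    (hp : 8 * Real.log (16 / δ) ≤ n * Q.real G) :
    (Measure.pi fun _ : Fin n => Q)
      {z | ∃ h ∈ H, Real.sqrt (192 * (n * Q.real G) * K) <
        |hits (disagreement π b G h) z - n * Q.real (disagreement π b G h)|} ≤
      ENNReal.ofReal (δ / 8) := by
  have h := measure_uniform_deviation_le_of_rate Q (n := n) (𝓕 := disagreement π b G '' H)
    (G := G) ?_ ?_ hG (traceBound_disagreement π b G hd hd0 hdn)
    (nullMeasurableSet_hitGap Q hπ hb hG hH) hδ hδ1 hK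
    ((Nat.floor_le (by positivity)).trans hNK) hp
  · simpa only [Set.exists_mem_image] using h
  · rintro _ ⟨h, hh, rfl⟩
    exact measurableSet_disagreement hπ hb hG (hHm h hh)
  · rintro _ ⟨h, -, rfl⟩
    exact fun z hz => hz.1

end UniformDeviation

/-! ### Effect of the corruption -/

section Corruption

theorem hits_eq_card {Z : Type*} {n : ℕ} (F : Set Z) [DecidablePred (· ∈ F)] (z : Fin n → Z) :
    hits F z = ((Finset.univ.filter fun i => z i ∈ F).card : ℝ) := by
  classical
  simp [hits, Set.indicator_apply]

theorem hits_nonneg {Z : Type*} {n : ℕ} (F : Set Z) (z : Fin n → Z) : 0 ≤ hits F z :=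
  Finset.sum_nonneg fun _ _ => Set.indicator_nonneg (fun _ _ => zero_le_one) _

theorem hits_mono {Z : Type*} {n : ℕ} {F F' : Set Z} (h : F ⊆ F') (z : Fin n → Z) :
    hits F z ≤ hits F' z :=
  Finset.sum_le_sum fun _ _ =>
    Set.indicator_le_indicator_of_subset h (fun _ => zero_le_one) _

theorem hits_union {Z : Type*} {n : ℕ} {F F' : Set Z} (h : Disjoint F F') (z : Fin n → Z) :
    hits (F ∪ F') z = hits F z + hits F' z := by
  rw [hits, hits, hits, ← Finset.sum_add_distrib, Set.indicator_union_of_disjoint h]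

variable {X : Type u} {n : ℕ}

/-- The marked outcomes. -/
def marked (X : Type u) : Set (Example X × Bool) := {z | z.2 = true}

/-- The unmarked outcomes of the event `{A = a, Y = 1}`. -/
def unmarkedGroup (X : Type u) (a : Bool) : Set (Example X × Bool) :=
  {z | z.1 ∈ posGroup X a ∧ z.2 = false}

theorem unmarkedGroup_eq_prod (a : Bool) : unmarkedGroup X a = posGroup X a ×ˢ {false} := by
  ext z
  simp [unmarkedGroup]

/-- The marked outcomes of the event `{A = a, Y = 1}`. -/
def markedGroup (X : Type u) (a : Bool) : Set (Example X × Bool) :=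
  {z | z.1 ∈ posGroup X a ∧ z.2 = true}

/-- The unmarked outcomes of the event `{A = a, Y = 1}` that are classified as positive. -/
def unmarkedPositive (a : Bool) (h : Classifier X) : Set (Example X × Bool) :=
  disagreement (fun z : Example X × Bool => z.1.1) (fun _ => false) (unmarkedGroup X a) h

/-- The misclassified outcomes. -/
def misclassified (h : Classifier X) : Set (Example X × Bool) :=
  disagreement (fun z : Example X × Bool => z.1.1) (fun z => z.1.2.2) Set.univ h

theorem unmarkedPositive_subset (a : Bool) (h : Classifier X) :
    unmarkedPositive a h ⊆ unmarkedGroup X a := fun _ hz => hz.1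

/-- The second sample arises from the first one by changes of marked examples. -/
def IsCorruption (z z' : Fin n → Example X × Bool) : Prop :=
  ∀ i, (z' i).2 = (z i).2 ∧ ((z i).2 = false → z' i = z i)

theorem IsCorruption.hits_eq {z z' : Fin n → Example X × Bool} (hz : IsCorruption z z')
    {F : Set (Example X × Bool)} (hF : ∀ w ∈ F, w.2 = false) : hits F z' = hits F z := by
  classical
  refine Finset.sum_congr rfl fun i _ => ?_
  obtain ⟨h1, h2⟩ := hz i
  by_cases hm : (z i).2 = false
  · rw [h2 hm]
  · rw [Set.indicator_of_notMem (fun h => hm (hF _ h)),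
      Set.indicator_of_notMem (fun h => hm (h1 ▸ hF _ h))]

theorem IsCorruption.hits_marked {z z' : Fin n → Example X × Bool} (hz : IsCorruption z z') :
    hits (marked X) z' = hits (marked X) z := by
  classical
  refine Finset.sum_congr rfl fun i _ => ?_
  simp only [Set.indicator_apply, marked, Set.mem_ofPred_eq, (hz i).1]

/-- The groups are disjoint: a marked point spent on one is not available for the other. -/
theorem hits_markedGroup_add_le (z : Fin n → Example X × Bool) :
    hits (markedGroup X false) z + hits (markedGroup X true) z ≤ hits (marked X) z := by
  rw [← hits_union]
  · refine hits_mono ?_ z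
    rintro w (hw | hw) <;> exact hw.2
  · refine Set.disjoint_left.2 fun w h1 h2 => ?_
    have := h1.1.1.symm.trans h2.1.1
    simp at this

/-- The difference is `(c j - N k) / (c (c + k))`, and both products in the numerator lie in `[0, c
k]`. -/
theorem abs_add_div_add_sub_div_le {N c j k : ℝ} (hN : 0 ≤ N) (hNc : N ≤ c) (hc : 0 < c)
    (hj : 0 ≤ j) (hjk : j ≤ k) : |(N + j) / (c + k) - N / c| ≤ k / (c + k) := by
  have hk : 0 ≤ k := hj.trans hjk
  have hck : 0 < c + k := by linarith
  have h : (N + j) / (c + k) - N / c = (c * j - N * k) / (c * (c + k)) := by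
    field_simp
    ring
  rw [h, abs_div, abs_of_pos (mul_pos hc hck), div_le_div_iff₀ (mul_pos hc hck) hck]
  have h1 : |c * j - N * k| ≤ k * c := by
    rw [abs_le]
    constructor <;> nlinarith
  calc |c * j - N * k| * (c + k) ≤ k * c * (c + k) := by gcongr
    _ = k * (c * (c + k)) := by ring

/-- The corruption moves the true positive rate by at most the share of the marked points. -/
theorem IsCorruption.abs_empTruePosRate_sub_le {z z' : Fin n → Example X × Bool}
    (hz : IsCorruption z z') (h : Classifier X) (a : Bool) (hc : 0 < hits (unmarkedGroup X a) z) :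
    |empTruePosRate (fun i => (z' i).1) h a -
        hits (unmarkedPositive a h) z / hits (unmarkedGroup X a) z| ≤
      hits (markedGroup X a) z' / (hits (unmarkedGroup X a) z + hits (markedGroup X a) z') := by
  classical
  let J : Set (Example X × Bool) := {w | h w.1.1 = true ∧ w ∈ markedGroup X a}
  have hden : ((Finset.univ.filter fun i =>
      (z' i).1.2.1 = a ∧ (z' i).1.2.2 = true).card : ℝ) =
      hits (unmarkedGroup X a) z + hits (markedGroup X a) z' := by
    rw [← hz.hits_eq (F := unmarkedGroup X a) (fun w hw => hw.2), ← hits_union, hits_eq_card]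
    · congr 2
      ext i
      simp only [Finset.mem_filter, Finset.mem_univ, true_and, unmarkedGroup, markedGroup,
        posGroup, Set.mem_union, Set.mem_ofPred_eq]
      cases (z' i).2 <;> simp
    · refine Set.disjoint_left.2 fun w h1 h2 => ?_
      have := h1.2.symm.trans h2.2
      simp at this
  have hnum : ((Finset.univ.filter fun i =>
      h (z' i).1.1 = true ∧ (z' i).1.2.1 = a ∧ (z' i).1.2.2 = true).card : ℝ) =
      hits (unmarkedPositive a h) z + hits J z' := by
    rw [← hz.hits_eq (F := unmarkedPositive a h) (fun w hw => hw.1.2), ← hits_union, hits_eq_card]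
    · congr 2
      ext i
      simp only [Finset.mem_filter, Finset.mem_univ, true_and, unmarkedPositive, disagreement, J,
        unmarkedGroup, markedGroup, posGroup, Set.mem_union, Set.mem_ofPred_eq]
      cases (z' i).2 <;> cases h (z' i).1.1 <;> simp
    · refine Set.disjoint_left.2 fun w h1 h2 => ?_
      have := h1.1.2.symm.trans h2.2.2
      simp at this
  unfold empTruePosRate
  rw [hden, hnum]
  exact abs_add_div_add_sub_div_le (hits_nonneg _ _) (hits_mono (unmarkedPositive_subset a h) z) hc
    (hits_nonneg _ _) (hits_mono (fun w hw => hw.2) _)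

/-- The corruption moves the empirical risk by at most the share of the marked points. -/
theorem IsCorruption.abs_empRisk_sub_le {z z' : Fin n → Example X × Bool}
    (hz : IsCorruption z z') (h : Classifier X) :
    |empRisk (fun i => (z' i).1) h - hits (misclassified h) z / n| ≤ hits (marked X) z / n := by
  classical
  have hnum : ((Finset.univ.filter fun i => h (z' i).1.1 ≠ (z' i).1.2.2).card : ℝ) =
      hits (misclassified h) z' := by
    rw [hits_eq_card]
    congr 2
    ext i
    simp [misclassified, disagreement]
  have hsplit : ∀ w : Fin n → Example X × Bool, hits (misclassified h) w =
      hits (misclassified h \ marked X) w + hits (misclassified h ∩ marked X) w := by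
    intro w
    rw [← hits_union Set.disjoint_sdiff_inter, Set.sdiff_union_inter]
  have h1 : hits (misclassified h \ marked X) z' = hits (misclassified h \ marked X) z :=
    hz.hits_eq fun w hw => by simpa [marked] using hw.2
  have h2 := hits_mono (Set.inter_subset_right (s := misclassified h) (t := marked X)) z
  have h3 := hits_mono (Set.inter_subset_right (s := misclassified h) (t := marked X)) z'
  rw [hz.hits_marked] at h3
  have h4 := hits_nonneg (misclassified h ∩ marked X) z
  have h5 := hits_nonneg (misclassified h ∩ marked X) z'
  unfold empRisk
  rw [hnum, ← sub_div, abs_div, Nat.abs_cast]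
  gcongr
  rw [hsplit z, hsplit z', h1, abs_le]
  constructor <;> linarith

/-- Concavity of `x / (c + x)`, as the tangent line at `m`. -/
theorem div_add_le_tangent {c m x : ℝ} (hc : 0 < c) (hm : 0 ≤ m) (hx : 0 ≤ x) :
    x / (c + x) ≤ m / (c + m) + c * (x - m) / (c + m) ^ 2 := by
  have h : m / (c + m) + c * (x - m) / (c + m) ^ 2 - x / (c + x) =
      c * (x - m) ^ 2 / ((c + m) ^ 2 * (c + x)) := by
    field_simp
    ring
  have : 0 ≤ c * (x - m) ^ 2 / ((c + m) ^ 2 * (c + x)) := by positivity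
  linarith

/-- The total shift of the two rates is at most the irreducible error. -/
theorem shift_le_irreducibleOpp {α p N c₀ c₁ k₀ k₁ : ℝ} (hα : 0 ≤ α) (hα' : α < 1 / 2)
    (hp : 0 < p) (hN : 0 < N) (hc₀ : N * ((1 - α) * p) / 2 ≤ c₀)
    (hc₁ : N * ((1 - α) * p) / 2 ≤ c₁) (hk₀ : 0 ≤ k₀) (hk₁ : 0 ≤ k₁)
    (hk : k₀ + k₁ ≤ 3 / 2 * (N * α)) :
    k₀ / (c₀ + k₀) + k₁ / (c₁ + k₁) ≤ irreducibleOpp α p := by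
  -- Since `1 - α ≥ 1/2`, this bounds both unmarked counts below. With `m` half of the budget `3/2 *
  -- N * α`, the value `2 m / (c + m)` is exactly the irreducible term.
  set c := N * p / 4 with hcdef
  have hc : 0 < c := by positivity
  have hle : c ≤ N * ((1 - α) * p) / 2 := by
    have : 0 < N * p := by positivity
    rw [hcdef]
    nlinarith
  set m := 3 / 4 * (N * α) with hm
  have hm0 : 0 ≤ m := by positivity
  have h0 : k₀ / (c₀ + k₀) ≤ k₀ / (c + k₀) := by
    gcongr
    linarith
  have h1 : k₁ / (c₁ + k₁) ≤ k₁ / (c + k₁) := by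
    gcongr
    linarith
  have t0 := div_add_le_tangent hc hm0 hk₀
  have t1 := div_add_le_tangent hc hm0 hk₁
  have t2 : c * (k₀ - m) / (c + m) ^ 2 + c * (k₁ - m) / (c + m) ^ 2 ≤ 0 := by
    rw [← add_div]
    refine div_nonpos_of_nonpos_of_nonneg ?_ (by positivity)
    rw [← mul_add]
    refine mul_nonpos_of_nonneg_of_nonpos hc.le ?_
    linarith
  have h2 : irreducibleOpp α p = m / (c + m) + m / (c + m) := by
    rw [irreducibleOpp, hcdef, hm]
    field_simp
    ring
  rw [h2]
  linarith

/-- Deviation of a ratio of hits from the ratio of the expectations. -/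
theorem abs_div_sub_div_le {N W q p n t : ℝ} (hn : 0 < n) (hp : 0 < p) (hq : 0 ≤ q) (hqp : q ≤ p)
    (hN : |N - n * q| ≤ t) (hW : |W - n * p| ≤ t) (hWp : n * p / 2 ≤ W) :
    |N / W - q / p| ≤ 4 * t / (n * p) := by
  have hnp : 0 < n * p := by positivity
  have hW0 : 0 < W := by linarith
  have ht : 0 ≤ t := (abs_nonneg _).trans hN
  have h : N / W - q / p = ((N - n * q) - q / p * (W - n * p)) / W := by
    field_simp
    ring
  have hqp' : q / p ≤ 1 := (div_le_one hp).2 hqp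
  have hqp0 : 0 ≤ q / p := by positivity
  have h1 : |(N - n * q) - q / p * (W - n * p)| ≤ t + t := by
    refine (abs_sub _ _).trans (add_le_add hN ?_)
    rw [abs_mul, abs_of_nonneg hqp0]
    nlinarith [abs_nonneg (W - n * p)]
  rw [h, abs_div, abs_of_pos hW0, div_le_div_iff₀ hW0 hnp]
  calc |(N - n * q) - q / p * (W - n * p)| * (n * p) ≤ (t + t) * (n * p) := by gcongr
    _ ≤ 4 * t * W := by nlinarith

/-- The loss `p ≥ P / 2` comes from unmarked points having mass `(1 - α) P₁ₐ`; the constant works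
because `192 * 2 ≤ 20²`. -/
theorem four_sqrt_div_le {n p P R : ℝ} (hn : 0 < n) (hP : 0 < P) (hp : P / 2 ≤ p) (hR : 0 ≤ R) :
    4 * Real.sqrt (192 * (n * p) * (n * R)) / (n * p) ≤ 80 * Real.sqrt (R / P) := by
  have hp0 : 0 < p := by linarith
  have h : Real.sqrt (192 * (n * p) * (n * R)) ≤ 20 * (n * p) * Real.sqrt (R / P) := by
    rw [Real.sqrt_le_left (by positivity), mul_pow, Real.sq_sqrt (by positivity)]
    have : (20 * (n * p)) ^ 2 * (R / P) = 400 * (n * p) * (n * R) * (p / P) := by ring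
    rw [this]
    have h2 : 1 / 2 ≤ p / P := by
      rw [le_div_iff₀ hP]
      linarith
    have h3 : 0 ≤ (n * p) * (n * R) := by positivity
    nlinarith
  rw [div_le_iff₀ (by positivity)]
  linarith

end Corruption

/-! ### The law of a marked example -/

section Law

variable {X : Type u} [MeasurableSpace X]

theorem isProbabilityMeasure_markLaw {α : ℝ} (hα : 0 ≤ α) (hα' : α < 1 / 2) :
    IsProbabilityMeasure (markLaw α) := by
  constructor
  simp only [markLaw, Measure.coe_add, Measure.coe_smul, Pi.add_apply, Pi.smul_apply,
    measure_univ, smul_eq_mul, mul_one]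
  rw [← ENNReal.ofReal_add hα (by linarith)]
  simp

theorem markLaw_real_true {α : ℝ} (hα : 0 ≤ α) : (markLaw α).real {true} = α := by
  simp [markLaw, measureReal_def, hα]

theorem markLaw_real_false {α : ℝ} (hα' : α < 1 / 2) : (markLaw α).real {false} = 1 - α := by
  have : 0 ≤ 1 - α := by linarith
  simp [markLaw, measureReal_def, this]

theorem measurableSet_posGroup (a : Bool) : MeasurableSet (posGroup X a) :=
  (measurableSet_eq_fun (by fun_prop) measurable_const).inter
    (measurableSet_eq_fun (by fun_prop) measurable_const)

theorem measurableSet_unmarkedGroup (a : Bool) : MeasurableSet (unmarkedGroup X a) := by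
  rw [unmarkedGroup_eq_prod]
  exact (measurableSet_posGroup a).prod (measurableSet_singleton _)

theorem measurableSet_marked : MeasurableSet (marked X) :=
  measurableSet_eq_fun measurable_snd measurable_const

variable (P : Measure (Example X)) {α : ℝ}

theorem real_prod_unmarkedGroup (hα : 0 ≤ α) (hα' : α < 1 / 2) (a : Bool) :
    (P.prod (markLaw α)).real (unmarkedGroup X a) = (1 - α) * posRate P a := by
  have := isProbabilityMeasure_markLaw hα hα'
  rw [unmarkedGroup_eq_prod, measureReal_prod_prod, markLaw_real_false hα', mul_comm, posRate]

theorem real_prod_unmarkedPositive (hα : 0 ≤ α) (hα' : α < 1 / 2) (a : Bool) (h : Classifier X) :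
    (P.prod (markLaw α)).real (unmarkedPositive a h) =
      (1 - α) * P.real (posGroup X a ∩ {z | h z.1 = true}) := by
  have := isProbabilityMeasure_markLaw hα hα'
  have hs : unmarkedPositive a h = (posGroup X a ∩ {z | h z.1 = true}) ×ˢ {false} := by
    ext z
    simp [unmarkedPositive, disagreement, unmarkedGroup]
    tauto
  rw [hs, measureReal_prod_prod, markLaw_real_false hα', mul_comm]

theorem real_prod_misclassified (hα : 0 ≤ α) (hα' : α < 1 / 2) (h : Classifier X) :
    (P.prod (markLaw α)).real (misclassified h) = risk P h := by
  have := isProbabilityMeasure_markLaw hα hα'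
  have hs : misclassified h = {z : Example X | h z.1 ≠ z.2.2} ×ˢ (Set.univ : Set Bool) := by
    ext z
    simp [misclassified, disagreement]
  rw [hs, measureReal_prod_prod, risk, probReal_univ, mul_one]

/-- Independence of the mark makes the factor `1 - α` cancel. -/
theorem truePosRate_eq_div (hα : 0 ≤ α) (hα' : α < 1 / 2) (a : Bool) (h : Classifier X) :
    truePosRate P h a = (P.prod (markLaw α)).real (unmarkedPositive a h) /
      (P.prod (markLaw α)).real (unmarkedGroup X a) := by
  rw [real_prod_unmarkedPositive P hα hα', real_prod_unmarkedGroup P hα hα',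
    mul_div_mul_left _ _ (by linarith), truePosRate, measureReal_def,
    ProbabilityTheory.cond_apply (measurableSet_posGroup a), ENNReal.toReal_mul,
    ENNReal.toReal_inv, posRate, measureReal_def, measureReal_def]
  ring

theorem map_prod_markLaw_input (hα : 0 ≤ α) (hα' : α < 1 / 2) :
    (P.prod (markLaw α)).map (fun z : Example X × Bool => z.1.1) = P.map Prod.fst := by
  have := isProbabilityMeasure_markLaw hα hα'
  have h : (fun z : Example X × Bool => z.1.1) = Prod.fst ∘ Prod.fst := rfl
  rw [h, ← Measure.map_map measurable_fst measurable_fst, Measure.map_fst_prod,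
    measure_univ, one_smul]

variable [IsProbabilityMeasure P]

theorem real_prod_marked (hα : 0 ≤ α) (hα' : α < 1 / 2) :
    (P.prod (markLaw α)).real (marked X) = α := by
  have := isProbabilityMeasure_markLaw hα hα'
  have h : marked X = Set.univ ×ˢ {true} := by
    ext z
    simp [marked]
  rw [h, measureReal_prod_prod, markLaw_real_true hα]
  simp

/-- Few points are marked. -/
theorem measure_marked_gt_le (hα : 0 ≤ α) (hα' : α < 1 / 2) {δ : ℝ} (hδ : 0 < δ) {n : ℕ}
    (hn : 12 * Real.log (12 / δ) / α ≤ n) :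
    (Measure.pi fun _ : Fin n => P.prod (markLaw α))
      {z | 3 / 2 * (n * α) < hits (marked X) z} ≤ ENNReal.ofReal (δ / 12) := by
  classical
  have := isProbabilityMeasure_markLaw hα hα'
  have hQ := real_prod_marked P hα hα'
  -- For `α = 0` the quotient in `hn` is `0` by convention and carries no information; the number of
  -- marks then has variance zero, so Chebyshev suffices.
  rcases hα.eq_or_lt with rfl | hpos
  · have h := measure_hits_chebyshev (P.prod (markLaw 0)) (n := n)
      (measurableSet_marked (X := X)) one_pos
    rw [hQ] at h
    refine (measure_mono fun z hz => ?_).trans (h.trans (ENNReal.ofReal_le_ofReal ?_))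
    · have hz' : 3 / 2 * (n * (0 : ℝ)) < hits (marked X) z := hz
      simp only [Set.mem_ofPred_eq]
      rw [hits_eq_card] at hz' ⊢
      simp only [mul_zero, Nat.cast_pos] at hz'
      rw [mul_zero, sub_zero, Nat.abs_cast]
      exact_mod_cast hz'
    · simp only [mul_zero, zero_div]
      positivity
  · have h := measure_hits_ge_three_halves_le (P.prod (markLaw α)) (n := n)
      (measurableSet_marked (X := X))
    rw [hQ] at h
    refine le_trans (measure_mono ?_) (h.trans (ENNReal.ofReal_le_ofReal ?_))
    · exact fun z hz => le_of_lt (Set.mem_ofPred_eq ▸ hz)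
    rw [div_le_iff₀ hpos] at hn
    calc Real.exp (-(n * α / 12)) ≤ Real.exp (-Real.log (12 / δ)) := by
          gcongr
          linarith
      _ = δ / 12 := by
          rw [Real.exp_neg, Real.exp_log (by positivity), inv_div]

/-- A set has at least half of its expected hits. -/
theorem measure_hits_lt_half_le {Z : Type*} [MeasurableSpace Z] (Q : Measure Z)
    [IsProbabilityMeasure Q] {G : Set Z} (hG : MeasurableSet G) {δ : ℝ} (hδ : 0 < δ) {n : ℕ}
    (hn : 8 * Real.log (16 / δ) ≤ n * Q.real G) :
    (Measure.pi fun _ : Fin n => Q) {z | hits G z < n * Q.real G / 2} ≤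
      ENNReal.ofReal (δ / 16) := by
  refine le_trans (measure_mono ?_)
    ((measure_hits_le_half_le Q hG).trans (ENNReal.ofReal_le_ofReal ?_))
  · exact fun z hz => le_of_lt (Set.mem_ofPred_eq ▸ hz)
  calc Real.exp (-(n * Q.real G / 8)) ≤ Real.exp (-Real.log (16 / δ)) := by
        gcongr
        linarith
    _ = δ / 16 := by
        rw [Real.exp_neg, Real.exp_log (by positivity), inv_div]

end Law

/-! ### The good event -/

section GoodEvent

variable {X : Type u} [MeasurableSpace X]

/-- The samples of marked examples with few marks, large groups and uniformly small deviations. -/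
structure GoodSample (P : Measure (Example X)) (H : Set (Classifier X)) (α K : ℝ) {n : ℕ}
    (z : Fin n → Example X × Bool) : Prop where
  marks : hits (marked X) z ≤ 3 / 2 * (n * α)
  large : ∀ a, n * (P.prod (markLaw α)).real (unmarkedGroup X a) / 2 ≤ hits (unmarkedGroup X a) z
  error : ∀ h ∈ H, |hits (misclassified h) z - n * (P.prod (markLaw α)).real (misclassified h)| ≤
    Real.sqrt (192 * n * K)
  group : ∀ a, |hits (unmarkedGroup X a) z - n * (P.prod (markLaw α)).real (unmarkedGroup X a)| ≤
    Real.sqrt (192 * (n * (P.prod (markLaw α)).real (unmarkedGroup X a)) * K)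
  positive : ∀ a, ∀ h ∈ H,
    |hits (unmarkedPositive a h) z - n * (P.prod (markLaw α)).real (unmarkedPositive a h)| ≤
      Real.sqrt (192 * (n * (P.prod (markLaw α)).real (unmarkedGroup X a)) * K)

variable (P : Measure (Example X)) [IsProbabilityMeasure P] {α : ℝ}

theorem measure_not_goodSample_lt {H : Set (Classifier X)} {d : ℕ} (hd : vcDim H = d)
    (hd0 : 0 < d) (hH : MeasurableClass P H) (hpos : 0 < posRate P false)
    (hle : posRate P false ≤ posRate P true) (hα : 0 ≤ α) (hα' : α < 1 / 2) {δ : ℝ} (hδ : 0 < δ)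
    (hδ1 : δ < 1) {n : ℕ} (hn1 : 8 * Real.log (16 / δ) / ((1 - α) * posRate P false) ≤ n)
    (hn2 : 12 * Real.log (12 / δ) / α ≤ n) (hdn : d ≤ n + n) {K : ℝ} (hK : 1 ≤ K)
    (hNK : (2 * Real.exp 1 * n / d) ^ d ≤ δ * Real.exp K) (hδK : 1 ≤ δ * Real.exp K) :
    (Measure.pi fun _ : Fin n => P.prod (markLaw α)) {z | ¬ GoodSample P H α K z} <
      ENNReal.ofReal δ := by
  have := isProbabilityMeasure_markLaw hα hα'
  set Q := P.prod (markLaw α) with hQ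
  set μ := Measure.pi fun _ : Fin n => Q
  have hpa : ∀ a, posRate P false ≤ posRate P a := by
    intro a
    cases a
    · exact le_rfl
    · exact hle
  have hlarge : ∀ a, 8 * Real.log (16 / δ) ≤ n * Q.real (unmarkedGroup X a) := by
    intro a
    rw [div_le_iff₀ (mul_pos (by linarith) hpos)] at hn1
    rw [hQ, real_prod_unmarkedGroup P hα hα']
    refine hn1.trans ?_
    have := hpa a
    have : 0 ≤ 1 - α := by linarith
    gcongr
  have huniv : 8 * Real.log (16 / δ) ≤ n * Q.real Set.univ :=
    (hlarge false).trans (mul_le_mul_of_nonneg_left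
      (measureReal_mono (Set.subset_univ _)) (Nat.cast_nonneg n))
  have hinput : ∀ (m : ℕ) (c : Fin m → Bool),
      NullMeasurableSet {x : Fin m → X | ∃ h ∈ H, ∀ i, h (x i) = c i}
        (Measure.pi fun _ => Q.map fun z : Example X × Bool => z.1.1) := by
    rw [hQ, map_prod_markLaw_input P hα hα']
    exact hH.2
  have hπ : Measurable fun z : Example X × Bool => z.1.1 := by fun_prop
  have e1 := measure_marked_gt_le P hα hα' hδ hn2
  have e2 := fun a => measure_hits_lt_half_le Q (n := n)
    (measurableSet_unmarkedGroup (X := X) a) hδ (hlarge a)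
  have e3 := measure_disagreement_deviation_le Q (n := n) hπ
    (b := fun z => z.1.2.2) (by fun_prop) MeasurableSet.univ hH.1 hinput hd hd0 hdn hδ hδ1 hK hNK
    huniv
  rw [probReal_univ, mul_one] at e3
  have e4 := fun a => measure_single_deviation_le Q (n := n)
    (measurableSet_unmarkedGroup (X := X) a) hδ hδ1 hK hδK (hlarge a)
  have e5 := fun a => measure_disagreement_deviation_le Q (n := n) hπ
    (b := fun _ => false) measurable_const (measurableSet_unmarkedGroup (X := X) a) hH.1 hinput
    hd hd0 hdn hδ hδ1 hK hNK (hlarge a)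
  have hbool : ∀ {E : Bool → Set (Fin n → Example X × Bool)} {c : ℝ}, 0 ≤ c →
      (∀ a, μ (E a) ≤ ENNReal.ofReal c) → μ (⋃ a, E a) ≤ ENNReal.ofReal (c + c) := by
    intro E c hc hE
    refine (measure_iUnion_fintype_le μ E).trans ?_
    rw [Fintype.sum_bool, ENNReal.ofReal_add hc hc]
    exact add_le_add (hE _) (hE _)
  have f2 := hbool (by positivity) e2
  have f4 := hbool (by positivity) e4
  have f5 := hbool (by positivity) e5
  refine lt_of_le_of_lt ((measure_mono ?_).trans ((measure_union_le _ _).trans (add_le_add e1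
    ((measure_union_le _ _).trans (add_le_add f2 ((measure_union_le _ _).trans (add_le_add e3
    ((measure_union_le _ _).trans (add_le_add f4 f5))))))))) ?_
  · intro z hz
    by_contra hcon
    simp only [Set.mem_union, not_or] at hcon
    obtain ⟨g1, g2, g3, g4, g5⟩ := hcon
    exact hz ⟨not_lt.1 g1, fun a => not_lt.1 fun h => g2 (Set.mem_iUnion.2 ⟨a, h⟩),
      fun h hh => not_lt.1 fun hlt => g3 ⟨h, hh, hlt⟩,
      fun a => not_lt.1 fun h => g4 (Set.mem_iUnion.2 ⟨a, h⟩),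
      fun a h hh => not_lt.1 fun hlt => g5 (Set.mem_iUnion.2 ⟨a, h, hh, hlt⟩)⟩
  -- The failure probabilities add up to `δ (1/12 + 1/8 + 1/8 + 1/4 + 1/4) = 5δ/6`, which gives the
  -- strict inequality.
  rw [← ENNReal.ofReal_add (by positivity) (by positivity),
    ← ENNReal.ofReal_add (by positivity) (by positivity),
    ← ENNReal.ofReal_add (by positivity) (by positivity),
    ← ENNReal.ofReal_add (by positivity) (by positivity)]
  refine (ENNReal.ofReal_lt_ofReal_iff hδ).2 ?_
  linarith

/-- On the good event the empirical objective is uniformly close to the objective. -/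
theorem GoodSample.abs_empOppObjective_sub_le {H : Set (Classifier X)} {lam R : ℝ}
    (hlam : 0 ≤ lam) (hpos : 0 < posRate P false) (hle : posRate P false ≤ posRate P true)
    (hα : 0 ≤ α) (hα' : α < 1 / 2) {n : ℕ} (hn : 0 < n) (hR : 0 ≤ R)
    {z z' : Fin n → Example X × Bool} (hz : GoodSample P H α (n * R) z) (hz' : IsCorruption z z')
    {h : Classifier X} (hh : h ∈ H) :
    |empOppObjective lam (fun i => (z' i).1) h - oppObjective P lam h| ≤
      3 / 2 * α + 14 * Real.sqrt R +
        lam * (irreducibleOpp α (posRate P false) + 160 * Real.sqrt (R / posRate P false)) := by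
  have := isProbabilityMeasure_markLaw hα hα'
  have hn' : (0 : ℝ) < n := by exact_mod_cast hn
  set Q := P.prod (markLaw α) with hQ
  have hpa : ∀ a, posRate P false ≤ posRate P a := by
    intro a
    cases a
    · exact le_rfl
    · exact hle
  have hG : ∀ a, Q.real (unmarkedGroup X a) = (1 - α) * posRate P a :=
    real_prod_unmarkedGroup P hα hα'
  have hGle : ∀ a, (1 - α) * posRate P false ≤ Q.real (unmarkedGroup X a) := by
    intro a
    rw [hG]
    have := hpa a
    have : 0 ≤ 1 - α := by linarith
    gcongr
  have hG0 : ∀ a, 0 < Q.real (unmarkedGroup X a) := fun a =>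
    lt_of_lt_of_le (mul_pos (by linarith) hpos) (hGle a)
  have hc : ∀ a, n * ((1 - α) * posRate P false) / 2 ≤ hits (unmarkedGroup X a) z := by
    intro a
    refine le_trans ?_ (hz.large a)
    have := hGle a
    gcongr
  have hc0 : ∀ a, 0 < hits (unmarkedGroup X a) z := fun a =>
    lt_of_lt_of_le (by have : 0 < 1 - α := by linarith
                       positivity) (hc a)
  have hrisk : |empRisk (fun i => (z' i).1) h - risk P h| ≤ 3 / 2 * α + 14 * Real.sqrt R := by
    have h1 := hz'.abs_empRisk_sub_le h
    have h2 : hits (marked X) z / n ≤ 3 / 2 * α := by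
      rw [div_le_iff₀ hn']
      linarith [hz.marks]
    have h3 : |hits (misclassified h) z / n - risk P h| ≤ 14 * Real.sqrt R := by
      have h4 := hz.error h hh
      rw [real_prod_misclassified P hα hα'] at h4
      have h5 : hits (misclassified h) z / n - risk P h =
          (hits (misclassified h) z - n * risk P h) / n := by
        field_simp
      rw [h5, abs_div, Nat.abs_cast, div_le_iff₀ hn']
      refine h4.trans ?_
      -- The constant `14` comes from `192 ≤ 14²`.
      rw [Real.sqrt_le_left (by positivity), mul_pow, mul_pow, Real.sq_sqrt hR]
      have : 0 ≤ (n : ℝ) * (n * R) := by positivity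
      nlinarith
    have h6 := abs_sub_le (empRisk (fun i => (z' i).1) h) (hits (misclassified h) z / n) (risk P h)
    linarith
  have hrate : ∀ a, |empTruePosRate (fun i => (z' i).1) h a - truePosRate P h a| ≤
      hits (markedGroup X a) z' / (hits (unmarkedGroup X a) z + hits (markedGroup X a) z') +
        80 * Real.sqrt (R / posRate P false) := by
    intro a
    have h1 := hz'.abs_empTruePosRate_sub_le h a (hc0 a)
    have h2 := abs_div_sub_div_le hn' (hG0 a) measureReal_nonneg
      (measureReal_mono (unmarkedPositive_subset a h)) (hz.positive a h hh) (hz.group a)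
      (hz.large a)
    rw [← truePosRate_eq_div P hα hα'] at h2
    have h3 := h2.trans (four_sqrt_div_le hn' hpos (by have := hGle a; nlinarith) hR)
    have h4 := abs_sub_le (empTruePosRate (fun i => (z' i).1) h a)
      (hits (unmarkedPositive a h) z / hits (unmarkedGroup X a) z) (truePosRate P h a)
    linarith
  have hshift := shift_le_irreducibleOpp hα hα' hpos hn' (hc false) (hc true)
    (hits_nonneg (markedGroup X false) z') (hits_nonneg (markedGroup X true) z')
    ((hits_markedGroup_add_le z').trans (hz'.hits_marked.le.trans hz.marks))
  have hdev : |empOppDeviation (fun i => (z' i).1) h - oppDeviation P h| ≤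
      irreducibleOpp α (posRate P false) + 160 * Real.sqrt (R / posRate P false) := by
    unfold empOppDeviation oppDeviation
    refine (abs_abs_sub_abs_le _ _).trans ?_
    rw [sub_sub_sub_comm]
    refine (abs_sub _ _).trans ?_
    linarith [hrate false, hrate true]
  unfold empOppObjective oppObjective
  rw [add_sub_add_comm, ← mul_sub]
  refine (abs_add_le _ _).trans (add_le_add hrisk ?_)
  rw [abs_mul, abs_of_nonneg hlam]
  gcongr

end GoodEvent

/-! ### ### From the good event to the learner -/

/-- The outcomes of the process as samples of marked examples. -/
theorem measurePreserving_process {X : Type u} [MeasurableSpace X] (P : Measure (Example X))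
    [IsProbabilityMeasure P] {α : ℝ} (hα : 0 ≤ α) (hα' : α < 1 / 2) {n : ℕ}
    (𝒜 : MaliciousAdversary.{u, v} X n) :
    MeasurePreserving
      (fun (ω : Dataset X n × (Fin n → Bool) × 𝒜.Seed) (i : Fin n) => (ω.1 i, ω.2.1 i))
      (processLaw P α 𝒜) (Measure.pi fun _ => P.prod (markLaw α)) := by
  have := isProbabilityMeasure_markLaw hα hα'
  have h1 := (MeasurePreserving.id (Measure.pi fun _ : Fin n => P)).prod
    (measurePreserving_fst (μ := Measure.pi fun _ : Fin n => markLaw α) (ν := 𝒜.seedLaw))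
  have h2 := (measurePreserving_arrowProdEquivProdArrow (Example X) Bool (Fin n) (fun _ => P)
    (fun _ => markLaw α)).symm
  exact h2.comp h1

/-- The excess error bound for a positive dimension. -/
theorem measure_excess_lt {X : Type u} [MeasurableSpace X] {H : Set (Classifier X)} {d : ℕ}
    (hd : vcDim H = d) (hd0 : 0 < d) {lam : ℝ} (hlam : 0 ≤ lam) {L : Learner X}
    (hL : IsOppMinimizer H lam L) (P : Measure (Example X)) [IsProbabilityMeasure P]
    (hH : MeasurableClass P H) (hpos : 0 < posRate P false)
    (hle : posRate P false ≤ posRate P true) {α : ℝ} (hα : 0 ≤ α) (hα' : α < 1 / 2) {δ : ℝ}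
    (hδ : 0 < δ) (hδ1 : δ < 1) {n : ℕ} (hn : 0 < n)
    (hn1 : 8 * Real.log (16 / δ) / ((1 - α) * posRate P false) ≤ n)
    (hn2 : 12 * Real.log (12 / δ) / α ≤ n) (hdn : (d : ℝ) / 2 ≤ n)
    (𝒜 : MaliciousAdversary.{u, v} X n) :
    processLaw P α 𝒜 {ω | ¬ oppObjective P lam (L n (corrupted 𝒜 ω)) ≤
        (⨅ h : H, oppObjective P lam h) + oppExcess 320 α lam (posRate P false) d n δ} <
      ENNReal.ofReal δ := by
  have hn' : (0 : ℝ) < n := by exact_mod_cast hn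
  have hd' : (0 : ℝ) < d := by exact_mod_cast hd0
  set R := logRate d δ n with hR
  have hRK : n * R = d * Real.log (2 * Real.exp 1 * n / d) + Real.log (1 / δ) := by
    rw [hR, logRate]
    field_simp
  have hlogδ : 0 ≤ Real.log (1 / δ) := Real.log_nonneg (by rw [le_div_iff₀ hδ]; linarith)
  -- The assumption `d / 2 ≤ n` enters here: the argument of the logarithm is at least `e`.
  have hlogd : 1 ≤ Real.log (2 * Real.exp 1 * n / d) := by
    rw [Real.le_log_iff_exp_le (by positivity), le_div_iff₀ hd']
    have := Real.exp_pos 1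
    nlinarith
  have hd1 : (1 : ℝ) ≤ d := by exact_mod_cast hd0
  have hK : 1 ≤ n * R := by
    rw [hRK]
    nlinarith
  have hR0 : 0 ≤ R := by
    by_contra hneg
    push Not at hneg
    nlinarith
  -- The rate is chosen so that `K = n R` meets the growth condition with equality.
  have hexp : δ * Real.exp (n * R) = (2 * Real.exp 1 * n / d) ^ d := by
    rw [hRK, Real.exp_add, Real.exp_log (by positivity), Real.exp_nat_mul,
      Real.exp_log (by positivity)]
    field_simp
  have hone : 1 ≤ δ * Real.exp (n * R) := by
    rw [hexp]
    refine one_le_pow₀ ?_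
    rw [Real.le_log_iff_exp_le (by positivity)] at hlogd
    exact le_trans (Real.one_le_exp (by norm_num)) hlogd
  have hdn' : d ≤ n + n := by
    have : (d : ℝ) ≤ (n + n : ℕ) := by
      push_cast
      linarith
    exact_mod_cast this
  have hbad := measure_not_goodSample_lt P hd hd0 hH hpos hle hα hα' hδ hδ1 hn1 hn2 hdn' hK
    hexp.symm.le hone
  set μ := Measure.pi fun _ : Fin n => P.prod (markLaw α)
  set B : Set (Fin n → Example X × Bool) := {z | ¬ GoodSample P H α (n * R) z}
  have hmp := measurePreserving_process P hα hα' 𝒜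
  refine lt_of_le_of_lt ?_ hbad
  -- Neither `B` nor the failure event need be measurable; a measurable hull of `B` lets the outer
  -- measure pass through the measure-preserving map.
  rw [← measure_toMeasurable B,
    ← hmp.measure_preimage (measurableSet_toMeasurable μ B).nullMeasurableSet]
  refine measure_mono fun ω hω => subset_toMeasurable μ B ?_
  intro hgood
  refine hω ?_
  set S := corrupted 𝒜 ω with hS
  obtain ⟨hLH, hLmin⟩ := hL n hn S
  have : Nonempty H := ⟨⟨_, hLH⟩⟩
  rw [← sub_le_iff_le_add]
  refine le_ciInf fun h => ?_
  have hcor : IsCorruption (fun i => (ω.1 i, ω.2.1 i)) (fun i => (S i, ω.2.1 i)) := by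
    refine fun i => ⟨rfl, fun hi => ?_⟩
    simp only [hS, corrupted]
    rw [𝒜.corrupt_unmarked _ _ _ i hi]
  have b1 := hgood.abs_empOppObjective_sub_le P hlam hpos hle hα hα' hn hR0 hcor hLH
  have b2 := hgood.abs_empOppObjective_sub_le P hlam hpos hle hα hα' hn hR0 hcor h.2
  have b3 := hLmin h h.2
  rw [abs_le] at b1 b2
  have b4 : 0 ≤ Real.sqrt R := Real.sqrt_nonneg _
  simp only [oppExcess]
  rw [← hR]
  -- Two uniform errors add up: `2 * 160 = 320` for the rates, while `2 * 14 ≤ 320` for the risk.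
  nlinarith [b1.1, b2.2]

end FairLearning

theorem theorem6 :
    ∃ C : ℝ, 0 < C ∧
      ∀ (X : Type u) [MeasurableSpace X]
        (H : Set (FairLearning.Classifier X)) (d : ℕ) (_ : FairLearning.vcDim H = (d : ℕ∞))
        (lam : ℝ) (_ : 0 ≤ lam)
        (L : FairLearning.Learner X) (_ : FairLearning.IsOppMinimizer H lam L)
        (P : Measure (FairLearning.Example X)) [IsProbabilityMeasure P]
        (_ : FairLearning.MeasurableClass P H)
        (_ : 0 < FairLearning.posRate P false)
        (_ : FairLearning.posRate P false ≤ FairLearning.posRate P true)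
        (α : ℝ) (_ : 0 ≤ α) (_ : α < 1 / 2)
        (δ : ℝ) (_ : 0 < δ) (_ : δ < 1)
        (n : ℕ)
        (_ : 8 * Real.log (16 / δ) / ((1 - α) * FairLearning.posRate P false) ≤ n)
        (_ : 12 * Real.log (12 / δ) / α ≤ n)
        (_ : (d : ℝ) / 2 ≤ n)
        (𝒜 : FairLearning.MaliciousAdversary.{u, v} X n),
        -- the failure event has (outer) probability less than `δ`
        FairLearning.processLaw P α 𝒜
            {ω | ¬ FairLearning.oppObjective P lam (L n (FairLearning.corrupted 𝒜 ω)) ≤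
                (⨅ h : H, FairLearning.oppObjective P lam h) +
                  FairLearning.oppExcess C α lam (FairLearning.posRate P false) d n δ} <
          ENNReal.ofReal δ := by
  refine ⟨320, by norm_num, ?_⟩
  intro X _ H d hd lam hlam L hL P _ hH hpos hle α hα hα' δ hδ hδ1 n hn1 hn2 hdn 𝒜
  have hn : 0 < n := by
    have hlog : 0 < Real.log (16 / δ) := Real.log_pos (by rw [lt_div_iff₀ hδ]; linarith)
    have hden : 0 < (1 - α) * FairLearning.posRate P false := mul_pos (by linarith) hpos
    have h : (0 : ℝ) < n := lt_of_lt_of_le (by positivity) hn1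
    exact_mod_cast h
  -- For `d = 0` the class has one member, which the learner must return; the excess is nonnegative,
  -- so failure is impossible.
  rcases Nat.eq_zero_or_pos d with rfl | hd0
  · have hsub := FairLearning.subsingleton_of_vcDim_eq_zero hd
    have hempty : {ω | ¬ FairLearning.oppObjective P lam (L n (FairLearning.corrupted 𝒜 ω)) ≤
        (⨅ h : H, FairLearning.oppObjective P lam h) +
          FairLearning.oppExcess 320 α lam (FairLearning.posRate P false) 0 n δ} = ∅ := by
      refine Set.eq_empty_of_forall_notMem fun ω hω => hω ?_
      have hLH := (hL n hn (FairLearning.corrupted 𝒜 ω)).1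
      have : Nonempty H := ⟨⟨_, hLH⟩⟩
      have hexc : 0 ≤ FairLearning.oppExcess 320 α lam (FairLearning.posRate P false) 0 n δ := by
        unfold FairLearning.oppExcess FairLearning.irreducibleOpp
        positivity
      refine le_add_of_le_of_nonneg (le_ciInf fun h => ?_) hexc
      rw [hsub hLH h.2]
    rw [hempty, measure_empty]
    exact ENNReal.ofReal_pos.2 hδ
  · exact FairLearning.measure_excess_lt hd hd0 hlam hL P hH hpos hle hα hα' hδ hδ1 hn hn1 hn2
      hdn 𝒜
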